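/- Let $T$ be Thompson's group: the group of all homeomorphisms of the circle $\mathbb{R}/\mathbb{Z}$ that map the set of dyadic points (classes of $a/2^n$, $a\in\mathbb{Z}$, $n\in\mathbb{N}$) onto itself and that, outside a finite set of dyadic points, are locally affine with slope an integer power of $2$. A pair of trees $(R,S,n)$ consists of two full binary trees with the same number $m$ of leaves and an integer $1\le n\le m$; the first leaf of $R$ is identified with the $n$-th leaf of $S$, and the remaining leaves are identified in cyclic order. Give the root of each tree the interval $[0,1)$ and give the left and right child of a vertex the left and right half of its interval. The pair $(R,S,n)$ represents $f\in T$ if $f$ maps the interval of each leaf of $R$ affinely, preserving orientation, onto the interval of the identified leaf of $S$. It is reduced if no two sibling leaves of $R$ are identified, left with left and right with right, with two sibling leaves of $S$. The Thompson graph of a full binary tree with leaves $l_1,\dots,l_m$ has vertices $v_1,\dots,v_m$, with $v_i$ immediately to the left of $l_i$, and one edge for each left edge $e$ of the tree: it joins the two vertices that can be connected by an arc above the line of leaves crossing the tree exactly once, at $e$. (If $e$ descends from the tree vertex $p$, these are the $v_i$ and $v_j$ for which $l_i$ is the leftmost leaf below $p$ and $l_j$ is the leftmost leaf at or below the right child of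 $p$.) The Thompson graph of $f\in T$ with reduced representation $(R,S,n)$ is the union of the Thompson graphs of $R$ and $S$, with their vertices identified in the same way as the leaves. Let $\vec T\subseteq T$ be the set of all $f\in T$ whose Thompson graph is bipartite. **Theorem.** The set $\vec T$ is a subgroup of $T$, and the quasiregular unitary representation $\lambda$ of $T$ on $\ell^2(T/\vec T)$, given by $(\lambda(g)v)(x)=v(g^{-1}x)$ for $g\in T$, $v\in\ell^2(T/\vec T)$ and $x\in T/\vec T$, is irreducible: $\ell^2(T/\vec T)\neq 0$, and its only closed $\lambda(T)$-invariant subspaces are $0$ and $\ell^2(T/\vec T)$. -/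

import Mathlib

open Topology

/-! ### Thompson's group `T` -/

/-- A point of the circle `ℝ / ℤ` is dyadic if it is the class of some `a / 2 ^ n`. -/
def IsDyadicPoint (x : UnitAddCircle) : Prop :=
  ∃ (a : ℤ) (n : ℕ), x = (((a : ℝ) / 2 ^ n : ℝ) : UnitAddCircle)

/-- `f` is affine with slope an integer power of `2` in a neighbourhood of `x`. -/
def IsDyadicAffineAt (f : UnitAddCircle → UnitAddCircle) (x : UnitAddCircle) : Prop :=
  ∃ k : ℤ, ∀ᶠ t : ℝ in 𝓝 0,
    f (x + (t : UnitAddCircle)) = f x + (((2 : ℝ) ^ k * t : ℝ) : UnitAddCircle)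

/-- The defining property of the elements of `T`: the homeomorphism maps the dyadic points onto
the dyadic points and is affine, with slopes integer powers of `2`, off a finite set of
dyadic points. -/
def IsThompsonHomeo (f : UnitAddCircle ≃ₜ UnitAddCircle) : Prop :=
  (∀ x, IsDyadicPoint (f x) ↔ IsDyadicPoint x) ∧
    ∃ B : Set UnitAddCircle, B.Finite ∧ (∀ x ∈ B, IsDyadicPoint x) ∧
      ∀ x, x ∉ B → IsDyadicAffineAt f x

theorem IsDyadicAffineAt.comp {f g : UnitAddCircle → UnitAddCircle} {x : UnitAddCircle}
    (hf : IsDyadicAffineAt f (g x)) (hg : IsDyadicAffineAt g x) :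
    IsDyadicAffineAt (f ∘ g) x := by
  obtain ⟨k, hk⟩ := hf
  obtain ⟨l, hl⟩ := hg
  refine ⟨k + l, ?_⟩
  have hc : Filter.Tendsto (fun t : ℝ => (2 : ℝ) ^ l * t) (𝓝 0) (𝓝 0) := by
    have : Continuous (fun t : ℝ => (2 : ℝ) ^ l * t) := by fun_prop
    simpa using this.tendsto 0
  filter_upwards [hl, hc.eventually hk] with t h1 h2
  simp only [Function.comp_apply]
  rw [h1, h2, zpow_add₀ (by norm_num : (2 : ℝ) ≠ 0), mul_assoc]

theorem IsDyadicAffineAt.symm {f : UnitAddCircle ≃ₜ UnitAddCircle} {x : UnitAddCircle}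
    (hf : IsDyadicAffineAt f x) : IsDyadicAffineAt f.symm (f x) := by
  obtain ⟨k, hk⟩ := hf
  refine ⟨-k, ?_⟩
  have hc : Filter.Tendsto (fun t : ℝ => (2 : ℝ) ^ (-k) * t) (𝓝 0) (𝓝 0) := by
    have : Continuous (fun t : ℝ => (2 : ℝ) ^ (-k) * t) := by fun_prop
    simpa using this.tendsto 0
  filter_upwards [hc.eventually hk] with t h
  rw [f.symm_apply_apply, f.symm_apply_eq, h, ← mul_assoc,
    ← zpow_add₀ (by norm_num : (2 : ℝ) ≠ 0)]
  simp

/-- Thompson's group `T`, as a group of homeomorphisms of the circle `ℝ / ℤ`. -/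
def ThompsonT : Subgroup (UnitAddCircle ≃ₜ UnitAddCircle) where
  carrier := {f | IsThompsonHomeo f}
  one_mem' := by
    refine ⟨fun x => Iff.rfl, ∅, Set.finite_empty, by simp, fun x _ => ⟨0, ?_⟩⟩
    exact Filter.Eventually.of_forall fun t => by simp
  mul_mem' := by
    rintro f g ⟨hf, B, hB, hBd, hBa⟩ ⟨hg, C, hC, hCd, hCa⟩
    refine ⟨fun x => (hf (g x)).trans (hg x), g ⁻¹' B ∪ C,
      (hB.preimage g.injective.injOn).union hC, ?_, ?_⟩
    · rintro x (hx | hx)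
      · exact (hg x).1 (hBd _ hx)
      · exact hCd x hx
    · intro x hx
      simp only [Set.mem_union, Set.mem_preimage, not_or] at hx
      exact (hBa _ hx.1).comp (hCa x hx.2)
  inv_mem' := by
    rintro f ⟨hf, B, hB, hBd, hBa⟩
    refine ⟨fun x => ?_, f '' B, hB.image f, ?_, ?_⟩
    · have h := hf (f.symm x)
      rw [f.apply_symm_apply] at h
      exact h.symm
    · rintro _ ⟨x, hx, rfl⟩
      exact (hf x).2 (hBd x hx)
    · intro y hy
      obtain ⟨x, rfl⟩ := f.surjective y
      exact (hBa x fun hx => hy ⟨x, hx, rfl⟩).symm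

/-! ### Pairs of full binary trees

Full binary trees are terms of `BinaryTree Unit`: `nil` is a single leaf, and `node () l r` is a
root with left subtree `l` and right subtree `r`. Leaves are numbered from left to right,
starting with `0`. -/

/-- The list, from left to right, of the end points `(c, d)` of the intervals `[c, d)` of the
leaves of a tree whose root carries the interval `[a, b)`; the two children of a vertex carry the
two halves of its interval. -/
noncomputable def leafIntervals : BinaryTree Unit → ℝ → ℝ → List (ℝ × ℝ)
  | .nil, a, b => [(a, b)]
  | .node _ l r, a, b => leafIntervals l a ((a + b) / 2) ++ leafIntervals r ((a + b) / 2) b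

/-- A pair of trees with the same number `m` of leaves, with a cyclic identification of their
leaves: leaf `i` of the input tree is identified with leaf `(i + shift) % m` of the output tree. -/
structure TreePair where
  input : BinaryTree Unit
  output : BinaryTree Unit
  numLeaves_eq : output.numLeaves = input.numLeaves
  shift : ℕ
  shift_lt : shift < input.numLeaves

/-- The number of the leaf of the output tree identified with leaf `i` of the input tree. -/
def TreePair.partner (P : TreePair) (i : ℕ) : ℕ := (i + P.shift) % P.input.numLeaves

/-- `P` is a pair of trees representation of `f`: the interval of each leaf of the input tree
is mapped affinely, preserving orientation, onto the interval of the identified leaf of the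
output tree. -/
def TreePair.Represents (P : TreePair) (f : UnitAddCircle → UnitAddCircle) : Prop :=
  ∀ (i : ℕ) (a b c d : ℝ), (leafIntervals P.input 0 1)[i]? = some (a, b) →
    (leafIntervals P.output 0 1)[P.partner i]? = some (c, d) →
    ∀ t ∈ Set.Ico a b,
      f (t : UnitAddCircle) = ((c + (d - c) / (b - a) * (t - a) : ℝ) : UnitAddCircle)

/-- Leaves `i` and `i + 1` of the tree are the left and right child of a common vertex. -/
def IsCaretAt : BinaryTree Unit → ℕ → Prop
  | .nil, _ => False
  | .node _ l r, i => (l = .nil ∧ r = .nil ∧ i = 0) ∨ IsCaretAt l i ∨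
      (l.numLeaves ≤ i ∧ IsCaretAt r (i - l.numLeaves))

/-- No dipole can be removed: no caret of leaves of the input tree is identified, left child with
left child and right child with right child, with a caret of leaves of the output tree. -/
def TreePair.IsReduced (P : TreePair) : Prop :=
  ∀ i, ¬ (IsCaretAt P.input i ∧ IsCaretAt P.output (P.partner i))

/-! ### Thompson graphs and the Jones subgroup -/

/-- The edges of the Thompson graph of a tree. Vertex `i` lies directly to the left of leaf `i`.
There is one edge for each left edge `e` of the tree: if `e` joins a vertex `p` to its
left child, then the arc crossing the tree only at `e` joins the graph vertex to the left of the
first leaf below `p` and the graph vertex to the left of the first leaf below the right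
child of `p`. -/
def ThompsonEdge : BinaryTree Unit → ℕ → ℕ → Prop
  | .nil, _, _ => False
  | .node _ l r, i, j => (i = 0 ∧ j = l.numLeaves) ∨ ThompsonEdge l i j ∨
      (l.numLeaves ≤ i ∧ l.numLeaves ≤ j ∧
        ThompsonEdge r (i - l.numLeaves) (j - l.numLeaves))

/-- The Thompson graph of a pair of trees: the union of the Thompson graphs of the two trees, their
vertices being identified as the leaves are. -/
def TreePair.thompsonGraph (P : TreePair) : SimpleGraph (Fin P.input.numLeaves) :=
  SimpleGraph.fromRel fun i j =>
    ThompsonEdge P.input i j ∨ ThompsonEdge P.output (P.partner i) (P.partner j)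

/-- The set underlying the Jones subgroup of `T`: all elements whose Thompson graph (that of the
reduced pair of trees representation) is bipartite. -/
def jonesSet : Set ThompsonT :=
  {f | ∃ P : TreePair, P.Represents f.1 ∧ P.IsReduced ∧ P.thompsonGraph.IsBipartite}

/-! ### Quasiregular representations -/

/-- The Hilbert space `ℓ²(X)` of square summable complex functions on a set. -/
noncomputable abbrev ellTwo (X : Type*) := lp (fun _ : X => ℂ) 2

theorem memLp_comp_equiv {X : Type*} (e : X ≃ X) {v : X → ℂ}
    (hv : Memℓp (E := fun _ : X => ℂ) v 2) : Memℓp (E := fun _ : X => ℂ) (fun x => v (e x)) 2 := by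
  have h2 : 0 < (2 : ENNReal).toReal := by norm_num
  rw [memℓp_gen_iff h2] at hv ⊢
  exact (e.summable_iff (f := fun x => ‖v x‖ ^ (2 : ENNReal).toReal)).2 hv

/-- The unitary operator `v ↦ (x ↦ v (g⁻¹ • x))` on `ℓ²(X)`, for `g` acting on `X`. -/
noncomputable def ellTwoTranslate {G X : Type*} [Group G] [MulAction G X] (g : G) :
    ellTwo X ≃ₗᵢ[ℂ] ellTwo X where
  toFun v := ⟨fun x => v (g⁻¹ • x), memLp_comp_equiv (MulAction.toPerm g⁻¹) v.2⟩
  invFun v := ⟨fun x => v (g • x), memLp_comp_equiv (MulAction.toPerm g) v.2⟩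
  left_inv v := by ext x; simp
  right_inv v := by ext x; simp
  map_add' v w := by ext x; rfl
  map_smul' c v := by ext x; simp
  norm_map' v := by
    have h2 : 0 < (2 : ENNReal).toReal := by norm_num
    rw [lp.norm_eq_tsum_rpow h2, lp.norm_eq_tsum_rpow h2]
    congr 1
    exact (MulAction.toPerm g⁻¹ : Equiv.Perm X).tsum_eq
      (fun x => ‖v x‖ ^ (2 : ENNReal).toReal)

/-- The quasiregular representation of `G` on `ℓ²(G ⧸ H)`:
`(λ(g) v)(x) = v (g⁻¹ x)` for `x` in the space `G ⧸ H` of left cosets. -/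
noncomputable def quasiregular {G : Type*} [Group G] (H : Subgroup G) :
    G →* (ellTwo (G ⧸ H) ≃ₗᵢ[ℂ] ellTwo (G ⧸ H)) where
  toFun g := ellTwoTranslate g
  map_one' := by
    ext v x
    change v ((1 : G)⁻¹ • x) = v x
    simp
  map_mul' g h := by
    ext v x
    change v ((g * h)⁻¹ • x) = v (h⁻¹ • g⁻¹ • x)
    rw [mul_inv_rev, mul_smul]

/-- A unitary representation on a Hilbert space is irreducible if the space is nonzero and its only
closed invariant subspaces are zero and the whole space. -/
def IsIrreducibleUnitary {G V : Type*} [Group G] [NormedAddCommGroup V] [InnerProductSpace ℂ V]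
    (π : G →* (V ≃ₗᵢ[ℂ] V)) : Prop :=
  Nontrivial V ∧ ∀ W : Submodule ℂ V, IsClosed (W : Set V) →
    (∀ g : G, ∀ v ∈ W, π g v ∈ W) → W = ⊥ ∨ W = ⊤

/-! The vertex to the left of a leaf is labelled by the left end point of the leaf's interval. An
edge of the Thompson graph of a tree then joins the left end point of a standard dyadic interval to
its midpoint, that is, it appends a binary digit 1. So the parity of the binary digit sum is a
proper 2-colouring of this graph, and since the graph is connected, it is the only one up to a
global flip. Hence the union of the two graphs is bipartite exactly when `f` changes the digit
parity of the left end points of all leaves by one constant. An affine map between standard dyadic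
intervals replaces a prefix of digits and keeps the tail, so this says that `f` preserves or
reverses the parity of all dyadic points (`mem_jonesSet_iff`). Such maps plainly form a group `H`.
The converse direction needs a reduced pair of trees for each element of `T`; its leaves are the
maximal standard dyadic intervals mapped affinely onto standard dyadic intervals
(`IsThompsonHomeo.exists_reduced`).

Irreducibility follows from a Mackey-type criterion (`quasiregular_irreducible`): it suffices that
for each `g ∉ H` some `h ∈ H` has an infinite forward orbit at the coset `gH`. Here one `h` serves
every `g`, the parity-preserving map `pinchT`, which fixes 0 and drives all points to 0. If a
positive power of `h` fixed `gH`, the parity of `g⁻¹ y` would be unchanged when this power is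
applied to `y`. Close to 0, on the right, `g⁻¹` shifts parity by a constant; pulling an arbitrary
dyadic point into that region shows that `g⁻¹` shifts parity by the same constant everywhere, so `g
∈ H` (`pinchT_pow_smul_ne`). -/

/-! ### Parity of the binary digit sum of a dyadic number -/

/-- The parity of the sum of the binary digits of the fractional part of a dyadic number. -/
noncomputable def digitParity (x : ℝ) : ZMod 2 :=
  ∑ᶠ i : ℕ, ((⌊(2 : ℝ) ^ (i + 1) * x⌋ : ℤ) : ZMod 2)

/-- Modulo 2, the floor of `2 ^ (i + 1) * x` is the binary digit of `x` at place `i + 1`. For `i ≥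
n` the number is already an even integer, so the sum has finite support and `finsum` does not fall
back to its default value. -/
theorem digitParity_eq_sum {x : ℝ} {n : ℕ} {c : ℤ} (h : (2 : ℝ) ^ n * x = c) :
    digitParity x = ∑ i ∈ Finset.range n, ((⌊(2 : ℝ) ^ (i + 1) * x⌋ : ℤ) : ZMod 2) := by
  refine finsum_eq_sum_of_support_subset _ fun i hi => ?_
  by_contra hn
  simp only [Finset.coe_range, Set.mem_Iio, not_lt] at hn
  obtain ⟨k, rfl⟩ := Nat.exists_eq_add_of_le hn
  apply hi
  beta_reduce
  have : (2 : ℝ) ^ (n + k + 1) * x = ((2 * (2 ^ k * c) : ℤ) : ℝ) := by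
    push_cast
    rw [← h]
    ring
  rw [this, Int.floor_intCast]
  push_cast
  rw [show (2 : ZMod 2) = 0 from rfl, zero_mul]

theorem digitParity_periodic : Function.Periodic digitParity 1 := by
  intro x
  refine finsum_congr fun i => ?_
  have : (2 : ℝ) ^ (i + 1) * (x + 1) = (2 : ℝ) ^ (i + 1) * x + ((2 * 2 ^ i : ℤ) : ℝ) := by
    push_cast
    ring
  rw [this, Int.floor_add_intCast]
  push_cast
  rw [show (2 : ZMod 2) = 0 from rfl, zero_mul, add_zero]

theorem digitParity_zero : digitParity 0 = 0 := by
  simp [digitParity]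

theorem digitParity_half : digitParity (1 / 2) = 1 := by
  rw [digitParity_eq_sum (n := 1) (c := 1) (by norm_num)]
  norm_num

/-- Real numbers of the form `c / 2 ^ n`. -/
def IsDyadicReal (x : ℝ) : Prop := ∃ (n : ℕ) (c : ℤ), (2 : ℝ) ^ n * x = c

theorem IsDyadicReal.half : IsDyadicReal (1 / 2) := ⟨1, 1, by norm_num⟩

theorem IsDyadicReal.intCast (a : ℤ) : IsDyadicReal a := ⟨0, a, by norm_num⟩

theorem IsDyadicReal.natCast (a : ℕ) : IsDyadicReal a := ⟨0, a, by norm_num⟩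

theorem IsDyadicReal.add {x y : ℝ} (hx : IsDyadicReal x) (hy : IsDyadicReal y) :
    IsDyadicReal (x + y) := by
  obtain ⟨n, c, h⟩ := hx
  obtain ⟨m, d, h'⟩ := hy
  refine ⟨n + m, 2 ^ m * c + 2 ^ n * d, ?_⟩
  push_cast
  rw [← h, ← h']
  ring

theorem IsDyadicReal.mul {x y : ℝ} (hx : IsDyadicReal x) (hy : IsDyadicReal y) :
    IsDyadicReal (x * y) := by
  obtain ⟨n, c, h⟩ := hx
  obtain ⟨m, d, h'⟩ := hy
  refine ⟨n + m, c * d, ?_⟩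
  push_cast
  rw [← h, ← h']
  ring

theorem IsDyadicReal.neg {x : ℝ} (hx : IsDyadicReal x) : IsDyadicReal (-x) := by
  simpa using hx.mul (IsDyadicReal.intCast (-1))

theorem IsDyadicReal.sub {x y : ℝ} (hx : IsDyadicReal x) (hy : IsDyadicReal y) :
    IsDyadicReal (x - y) := by
  simpa [sub_eq_add_neg] using hx.add hy.neg

theorem IsDyadicReal.div_pow {x : ℝ} (hx : IsDyadicReal x) (k : ℕ) :
    IsDyadicReal (x / 2 ^ k) := by
  obtain ⟨n, c, h⟩ := hx
  refine ⟨n + k, c, ?_⟩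
  rw [← h]
  field_simp
  ring

/-! ### Dyadic points of the circle, and concatenation of binary expansions -/

theorem unitAddCircle_coe_eq_iff {x y : ℝ} :
    (x : UnitAddCircle) = y ↔ ∃ k : ℤ, y = x + k := by
  rw [QuotientAddGroup.eq, AddSubgroup.mem_zmultiples_iff]
  refine exists_congr fun k => ?_
  simp only [zsmul_eq_mul, mul_one]
  constructor <;> intro h <;> linarith

theorem isDyadicPoint_coe {x : ℝ} : IsDyadicPoint (x : UnitAddCircle) ↔ IsDyadicReal x := by
  constructor
  · rintro ⟨a, n, h⟩
    obtain ⟨k, hk⟩ := unitAddCircle_coe_eq_iff.1 h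
    have : x = (a : ℝ) / 2 ^ n - (k : ℝ) := by
      linarith
    rw [this]
    exact ((IsDyadicReal.intCast a).div_pow n).sub (IsDyadicReal.intCast k)
  · rintro ⟨n, c, h⟩
    exact ⟨c, n, by rw [← h]; field_simp⟩

/-- The expansion of `(a + t) / 2 ^ n` consists of the `n` fractional digits of `a / 2 ^ n`, up to
an integer, followed by those of `t`. This is why affine maps between standard dyadic intervals
shift parity by a constant. -/
theorem digitParity_add_div {t : ℝ} (h0 : 0 ≤ t) (h1 : t < 1) (ht : IsDyadicReal t) (a : ℤ)
    (n : ℕ) : digitParity ((a + t) / 2 ^ n) = digitParity (a / 2 ^ n) + digitParity t := by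
  obtain ⟨k, c, hc⟩ := ht
  have hs : (2 : ℝ) ^ (n + k) * ((a + t) / 2 ^ n) = ((2 ^ k * a + c : ℤ) : ℝ) := by
    push_cast
    rw [← hc]
    field_simp
    ring
  rw [digitParity_eq_sum hs, digitParity_eq_sum hc,
    digitParity_eq_sum (x := (a : ℝ) / 2 ^ n) (n := n) (c := a) (by field_simp),
    Finset.sum_range_add]
  congr 1
  -- In the first `n` places the floors do not see `t`, because `0 ≤ t < 1`.
  · refine Finset.sum_congr rfl fun i hi => ?_
    obtain ⟨j, rfl⟩ := Nat.exists_eq_add_of_lt (Finset.mem_range.1 hi)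
    have e : ∀ y : ℝ, (2 : ℝ) ^ (i + 1) * (y / 2 ^ (i + j + 1)) = y / ((2 ^ j : ℕ) : ℝ) := by
      intro y
      push_cast
      field_simp
      ring
    rw [e, e, Int.floor_div_natCast, Int.floor_div_natCast, Int.floor_intCast,
      Int.floor_intCast_add, Int.floor_eq_zero_iff.2 ⟨h0, h1⟩, add_zero]
  -- In the later places `a` contributes only an even integer.
  · refine Finset.sum_congr rfl fun i hi => ?_
    have : (2 : ℝ) ^ (n + i + 1) * ((a + t) / 2 ^ n) =
        ((2 * (2 ^ i * a) : ℤ) : ℝ) + 2 ^ (i + 1) * t := by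
      push_cast
      field_simp
      ring
    rw [this, Int.floor_intCast_add]
    push_cast
    rw [show (2 : ZMod 2) = 0 from rfl, zero_mul, zero_add]

theorem digitParity_double_succ (a : ℤ) (n : ℕ) :
    digitParity ((2 * a + 1) / 2 ^ (n + 1)) = digitParity (a / 2 ^ n) + 1 := by
  rw [← digitParity_half, ← digitParity_add_div (by norm_num) (by norm_num) .half]
  congr 1
  field_simp
  ring

/-- The parity of the binary digit sum of a dyadic point of the circle. -/
noncomputable def pointParity : UnitAddCircle → ZMod 2 := digitParity_periodic.lift

theorem pointParity_coe (x : ℝ) : pointParity (x : UnitAddCircle) = digitParity x := rfl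

theorem exists_coe_mem_Ico (x : UnitAddCircle) : ∃ t : ℝ, 0 ≤ t ∧ t < 1 ∧ x = (t : UnitAddCircle) := by
  obtain ⟨y, rfl⟩ := QuotientAddGroup.mk_surjective x
  refine ⟨Int.fract y, Int.fract_nonneg y, Int.fract_lt_one y, ?_⟩
  refine unitAddCircle_coe_eq_iff.2 ⟨-⌊y⌋, ?_⟩
  simp [Int.fract, sub_eq_add_neg]

theorem coe_inj_of_mem_Ico {x y : ℝ} (hx : 0 ≤ x) (hx' : x < 1) (hy : 0 ≤ y) (hy' : y < 1)
    (h : (x : UnitAddCircle) = y) : x = y :=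
  (AddCircle.coe_eq_coe_iff_of_mem_Ico (p := 1) (a := 0) (by simp [*]) (by simp [*])).1 h

/-! ### Standard dyadic intervals mapped affinely onto standard dyadic intervals -/

/-- `f` maps the class of `[x, y]` affinely onto the class of `[x', y']`. -/
def MapsAffinely (f : UnitAddCircle → UnitAddCircle) (x y x' y' : ℝ) : Prop :=
  ∀ t ∈ Set.Icc (0 : ℝ) 1,
    f ((x + (y - x) * t : ℝ) : UnitAddCircle) = ((x' + (y' - x') * t : ℝ) : UnitAddCircle)

theorem map_coe_congr {f : UnitAddCircle → UnitAddCircle} {p q p' q' : ℝ}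
    (h : f (p : UnitAddCircle) = (q : UnitAddCircle)) (hp : p' = p) (hq : q' = q) :
    f (p' : UnitAddCircle) = (q' : UnitAddCircle) := by
  rw [hp, hq, h]

namespace MapsAffinely

variable {f : UnitAddCircle → UnitAddCircle} {x y z x' y' z' : ℝ}

theorem left (h : MapsAffinely f x y x' y') :
    MapsAffinely f x ((x + y) / 2) x' ((x' + y') / 2) := by
  intro t ht
  have := h (t / 2) ⟨by linarith [ht.1], by linarith [ht.2]⟩
  exact map_coe_congr this (by ring) (by ring)

theorem right (h : MapsAffinely f x y x' y') :
    MapsAffinely f ((x + y) / 2) y ((x' + y') / 2) y' := by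
  intro t ht
  have := h ((1 + t) / 2) ⟨by linarith [ht.1], by linarith [ht.2]⟩
  exact map_coe_congr this (by ring) (by ring)

theorem glue (h : MapsAffinely f x ((x + y) / 2) x' ((x' + y') / 2))
    (h' : MapsAffinely f ((x + y) / 2) y ((x' + y') / 2) y') : MapsAffinely f x y x' y' := by
  intro t ht
  rcases le_total t (1 / 2) with h2 | h2
  · have := h (2 * t) ⟨by linarith [ht.1], by linarith⟩
    exact map_coe_congr this (by ring) (by ring)
  · have := h' (2 * t - 1) ⟨by linarith, by linarith [ht.2]⟩
    exact map_coe_congr this (by ring) (by ring)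

theorem map_left (h : MapsAffinely f x y x' y') : f (x : UnitAddCircle) = (x' : UnitAddCircle) := by
  simpa using h 0 (by simp)

theorem map_right (h : MapsAffinely f x y x' y') : f (y : UnitAddCircle) = (y' : UnitAddCircle) := by
  simpa using h 1 (by simp)

theorem symm {f : UnitAddCircle ≃ₜ UnitAddCircle} (h : MapsAffinely f x y x' y') :
    MapsAffinely f.symm x' y' x y := by
  intro t ht
  rw [← h t ht, f.symm_apply_apply]

end MapsAffinely

/-- The dyadic number `a / 2 ^ n`. -/
noncomputable def dyadic (n a : ℕ) : ℝ := (a : ℝ) / 2 ^ n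

theorem dyadic_succ_double (n a : ℕ) : dyadic (n + 1) (2 * a) = dyadic n a := by
  unfold dyadic
  push_cast
  field_simp
  ring

theorem dyadic_succ_double_add_one (n a : ℕ) :
    dyadic (n + 1) (2 * a + 1) = (dyadic n a + dyadic n (a + 1)) / 2 := by
  unfold dyadic
  push_cast
  field_simp
  ring

theorem dyadic_nonneg (n a : ℕ) : 0 ≤ dyadic n a := by
  unfold dyadic
  positivity

theorem dyadic_lt_one {n a : ℕ} (h : a < 2 ^ n) : dyadic n a < 1 := by
  unfold dyadic
  rw [div_lt_one (by positivity)]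
  exact_mod_cast h

theorem dyadic_sub (n a : ℕ) : dyadic n (a + 1) - dyadic n a = 1 / 2 ^ n := by
  unfold dyadic
  push_cast
  ring

theorem dyadic_lt_succ (n a : ℕ) : dyadic n a < dyadic n (a + 1) := by
  have := dyadic_sub n a
  have : (0 : ℝ) < 1 / 2 ^ n := by positivity
  linarith

theorem isDyadicReal_dyadic (n a : ℕ) : IsDyadicReal (dyadic n a) :=
  (IsDyadicReal.natCast a).div_pow n

theorem dyadic_interval_inj {n a m b : ℕ} (h : dyadic n a = dyadic m b)
    (h' : dyadic n (a + 1) - dyadic n a = dyadic m (b + 1) - dyadic m b) : n = m ∧ a = b := by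
  rw [dyadic_sub, dyadic_sub, one_div, one_div, inv_inj] at h'
  have hnm : n = m := pow_right_injective₀ (M₀ := ℝ) (by norm_num) (by norm_num) h'
  subst hnm
  refine ⟨rfl, ?_⟩
  unfold dyadic at h
  rw [div_left_inj' (by positivity)] at h
  exact_mod_cast h

/-- `f` maps the standard dyadic interval `[a / 2 ^ n, (a + 1) / 2 ^ n]` affinely onto a standard
dyadic interval. -/
def IsGood (f : UnitAddCircle → UnitAddCircle) (n a : ℕ) : Prop :=
  ∃ m b, b < 2 ^ m ∧ MapsAffinely f (dyadic n a) (dyadic n (a + 1)) (dyadic m b) (dyadic m (b + 1))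

theorem MapsAffinely.dyadic_left {f : UnitAddCircle → UnitAddCircle} {n a m b : ℕ}
    (h : MapsAffinely f (dyadic n a) (dyadic n (a + 1)) (dyadic m b) (dyadic m (b + 1))) :
    MapsAffinely f (dyadic (n + 1) (2 * a)) (dyadic (n + 1) (2 * a + 1))
      (dyadic (m + 1) (2 * b)) (dyadic (m + 1) (2 * b + 1)) := by
  simpa only [dyadic_succ_double, dyadic_succ_double_add_one] using h.left

theorem MapsAffinely.dyadic_right {f : UnitAddCircle → UnitAddCircle} {n a m b : ℕ}
    (h : MapsAffinely f (dyadic n a) (dyadic n (a + 1)) (dyadic m b) (dyadic m (b + 1))) :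
    MapsAffinely f (dyadic (n + 1) (2 * a + 1)) (dyadic (n + 1) (2 * a + 1 + 1))
      (dyadic (m + 1) (2 * b + 1)) (dyadic (m + 1) (2 * b + 1 + 1)) := by
  have e : ∀ c, 2 * c + 1 + 1 = 2 * (c + 1) := fun c => by ring
  simpa only [e, dyadic_succ_double, dyadic_succ_double_add_one] using h.right

theorem IsGood.double {f : UnitAddCircle → UnitAddCircle} {n a : ℕ} (h : IsGood f n a) :
    IsGood f (n + 1) (2 * a) := by
  obtain ⟨m, b, hb, h⟩ := h
  exact ⟨m + 1, 2 * b, by rw [pow_succ]; omega, h.dyadic_left⟩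

theorem IsGood.double_add_one {f : UnitAddCircle → UnitAddCircle} {n a : ℕ} (h : IsGood f n a) :
    IsGood f (n + 1) (2 * a + 1) := by
  obtain ⟨m, b, hb, h⟩ := h
  exact ⟨m + 1, 2 * b + 1, by rw [pow_succ]; omega, h.dyadic_right⟩

theorem isGood_of_int {f : UnitAddCircle → UnitAddCircle} {n a m : ℕ} (b : ℤ)
    (h : ∀ t ∈ Set.Icc (0 : ℝ) 1, f (((a + t) / 2 ^ n : ℝ) : UnitAddCircle) =
      (((b + t) / 2 ^ m : ℝ) : UnitAddCircle)) : IsGood f n a := by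
  have h2 : (0 : ℤ) < 2 ^ m := by positivity
  -- Changing `b` by a multiple of `2 ^ m` moves the image by an integer, which the circle does not
  -- see.
  refine ⟨m, (b % 2 ^ m).toNat, ?_, fun t ht => ?_⟩
  · have := Int.emod_lt_of_pos b h2
    have := Int.emod_nonneg b h2.ne'
    zify
    rw [Int.toNat_of_nonneg this]
    assumption
  · have e : ((b % 2 ^ m).toNat : ℝ) = b - 2 ^ m * (b / 2 ^ m : ℤ) := by
      have h3 : (((b % 2 ^ m).toNat : ℤ) : ℝ) = ((b % 2 ^ m : ℤ) : ℝ) := by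
        rw [Int.toNat_of_nonneg (Int.emod_nonneg b h2.ne')]
      rw [Int.emod_def] at h3
      push_cast at h3
      rw [Int.emod_def]
      exact h3
    rw [dyadic_sub, dyadic_sub]
    have h4 := h t ht
    rw [show ((a : ℝ) + t) / 2 ^ n = dyadic n a + 1 / 2 ^ n * t by unfold dyadic; ring] at h4
    · rw [h4]
      symm
      refine unitAddCircle_coe_eq_iff.2 ⟨b / 2 ^ m, ?_⟩
      unfold dyadic
      rw [e]
      field_simp
      ring

/-! ### Subdivisions adapted to an element of `T` -/

theorem slope_unique {k l : ℤ} (h : ∀ᶠ s : ℝ in 𝓝 0,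
    (((2 : ℝ) ^ k * s : ℝ) : UnitAddCircle) = ((2 : ℝ) ^ l * s : ℝ)) : k = l := by
  have hc : Filter.Tendsto (fun s : ℝ => (2 : ℝ) ^ l * s - 2 ^ k * s) (𝓝 0) (𝓝 0) := by
    have : Continuous (fun s : ℝ => (2 : ℝ) ^ l * s - 2 ^ k * s) := by fun_prop
    simpa using this.tendsto 0
  have h1 := hc.eventually (Ioo_mem_nhds (show (-1 : ℝ) < 0 by norm_num) one_pos)
  obtain ⟨s, ⟨hs, hs1⟩, hs0⟩ :=
    (((h.and h1).filter_mono nhdsWithin_le_nhds).and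
      (self_mem_nhdsWithin (a := (0 : ℝ)) (s := Set.Ioi 0))).exists
  obtain ⟨j, hj⟩ := unitAddCircle_coe_eq_iff.1 hs
  have hj0 : j = 0 := by
    have e : (2 : ℝ) ^ l * s - 2 ^ k * s = j := by linarith
    rw [e] at hs1
    have h2 : (-1 : ℤ) < j := by exact_mod_cast hs1.1
    have h3 : j < (1 : ℤ) := by exact_mod_cast hs1.2
    omega
  rw [hj0] at hj
  have hs0' : s ≠ 0 := ne_of_gt hs0
  have : (2 : ℝ) ^ l = 2 ^ k := mul_right_cancel₀ hs0' (by simpa using hj)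
  exact (zpow_right_injective₀ (by norm_num) (by norm_num) this).symm

theorem exists_affine_on_Ioo {f : UnitAddCircle → UnitAddCircle} {α β : ℝ} (hαβ : α < β)
    (h : ∀ x ∈ Set.Ioo α β, IsDyadicAffineAt f (x : UnitAddCircle)) :
    ∃ (k : ℤ) (w : UnitAddCircle), ∀ x ∈ Set.Ioo α β,
      f (x : UnitAddCircle) = (((2 : ℝ) ^ k * x : ℝ) : UnitAddCircle) + w := by
  choose k hk using fun x : Set.Ioo α β => h x x.2
  -- The local slope exponent together with the local intercept is locally constant, hence constant
  -- on the connected interval.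
  let φ : Set.Ioo α β → ℤ × UnitAddCircle := fun x =>
    (k x, f ((x : ℝ) : UnitAddCircle) - (((2 : ℝ) ^ k x * x : ℝ) : UnitAddCircle))
  have hφ : IsLocallyConstant φ := by
    rw [IsLocallyConstant.iff_eventually_eq]
    intro x
    have hc : Filter.Tendsto (fun y : Set.Ioo α β => (y : ℝ) - x) (𝓝 x) (𝓝 0) := by
      have : Continuous (fun y : Set.Ioo α β => (y : ℝ) - x) := by fun_prop
      simpa using this.tendsto x
    filter_upwards [hc.eventually (eventually_eventually_nhds.2 (hk x))] with y hy
    have hy0 := hy.self_of_nhds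
    rw [← AddCircle.coe_add, add_sub_cancel] at hy0
    have hky : k y = k x := by
      apply slope_unique
      have ht : Filter.Tendsto (fun s : ℝ => (y : ℝ) - x + s) (𝓝 0) (𝓝 ((y : ℝ) - x)) := by
        have : Continuous (fun s : ℝ => (y : ℝ) - x + s) := by fun_prop
        simpa using this.tendsto 0
      filter_upwards [hk y, ht.eventually hy] with s h1 h2
      rw [← AddCircle.coe_add] at h1 h2
      rw [show (x : ℝ) + (y - x + s) = y + s by ring, h1, hy0, add_assoc] at h2
      have h3 := add_left_cancel h2
      rw [mul_add, AddCircle.coe_add] at h3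
      exact add_left_cancel h3
    refine Prod.ext hky ?_
    change f ((y : ℝ) : UnitAddCircle) - (((2 : ℝ) ^ k y * y : ℝ) : UnitAddCircle) =
      f ((x : ℝ) : UnitAddCircle) - (((2 : ℝ) ^ k x * x : ℝ) : UnitAddCircle)
    rw [hy0, hky, mul_sub, AddCircle.coe_sub]
    abel
  obtain ⟨x₀, hx₀⟩ := Set.nonempty_Ioo.2 hαβ
  have : PreconnectedSpace (Set.Ioo α β) := Subtype.preconnectedSpace isPreconnected_Ioo
  refine ⟨k ⟨x₀, hx₀⟩, (φ ⟨x₀, hx₀⟩).2, fun x hx => ?_⟩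
  have e := hφ.apply_eq_of_preconnectedSpace ⟨x₀, hx₀⟩ ⟨x, hx⟩
  have e1 : k ⟨x₀, hx₀⟩ = k ⟨x, hx⟩ := congrArg Prod.fst e
  rw [e, e1]
  simp [φ]

theorem exists_affine_on_Icc {f : UnitAddCircle → UnitAddCircle} (hf : Continuous f) {α β : ℝ}
    (hαβ : α < β) (h : ∀ x ∈ Set.Ioo α β, IsDyadicAffineAt f (x : UnitAddCircle)) :
    ∃ k : ℤ, ∀ x ∈ Set.Icc α β,
      f (x : UnitAddCircle) = f (α : UnitAddCircle) + (((2 : ℝ) ^ k * (x - α) : ℝ) : UnitAddCircle) := by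
  obtain ⟨k, w, hk⟩ := exists_affine_on_Ioo hαβ h
  have h1 : Set.EqOn (fun x : ℝ => f (x : UnitAddCircle))
      (fun x : ℝ => (((2 : ℝ) ^ k * x : ℝ) : UnitAddCircle) + w) (closure (Set.Ioo α β)) := by
    refine Set.EqOn.closure hk ?_ ?_
    · exact hf.comp (AddCircle.continuous_mk' 1)
    · exact ((AddCircle.continuous_mk' 1).comp (by fun_prop)).add continuous_const
  rw [closure_Ioo hαβ.ne] at h1
  refine ⟨k, fun x hx => ?_⟩
  have e1 := h1 hx
  have e2 := h1 (Set.left_mem_Icc.2 hαβ.le)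
  beta_reduce at e1 e2
  rw [e1, e2, mul_sub, AddCircle.coe_sub]
  abel

theorem IsThompsonHomeo.exists_affine_level {f : UnitAddCircle ≃ₜ UnitAddCircle}
    (hf : IsThompsonHomeo f) : ∃ N : ℕ, ∀ a : ℕ, ∃ k : ℤ, ∀ x ∈ Set.Icc (dyadic N a) (dyadic N (a + 1)),
      f (x : UnitAddCircle) = f (dyadic N a : UnitAddCircle) +
        (((2 : ℝ) ^ k * (x - dyadic N a) : ℝ) : UnitAddCircle) := by
  obtain ⟨-, B, hB, hBd, hBa⟩ := hf
  have h1 : ∀ x ∈ B, ∀ᶠ N : ℕ in Filter.atTop,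
      ∃ c : ℤ, x = (((c : ℝ) / 2 ^ N : ℝ) : UnitAddCircle) := by
    intro x hx
    obtain ⟨a, n, rfl⟩ := hBd x hx
    filter_upwards [Filter.eventually_ge_atTop n] with N hN
    obtain ⟨j, rfl⟩ := Nat.exists_eq_add_of_le hN
    refine ⟨a * 2 ^ j, ?_⟩
    congr 1
    push_cast
    field_simp
    ring
  -- At this level every breakpoint is a multiple of `1 / 2 ^ N`, so none lies inside a subdivision
  -- interval.
  obtain ⟨N, hN⟩ := ((Filter.eventually_all_finite hB).2 h1).exists
  refine ⟨N, fun a => exists_affine_on_Icc f.continuous (dyadic_lt_succ N a) fun x hx => ?_⟩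
  refine hBa _ fun hxB => ?_
  obtain ⟨c, hc⟩ := hN _ hxB
  obtain ⟨j, hj⟩ := unitAddCircle_coe_eq_iff.1 hc
  have hx' : x = ((c - 2 ^ N * j : ℤ) : ℝ) / 2 ^ N := by
    push_cast
    rw [sub_div, hj]
    field_simp
    ring
  rw [hx'] at hx
  unfold dyadic at hx
  have hp : (0 : ℝ) < 2 ^ N := by positivity
  have h2 := (div_lt_div_iff_of_pos_right hp).1 hx.1
  have h3 := (div_lt_div_iff_of_pos_right hp).1 hx.2
  have h4 : (a : ℤ) < c - 2 ^ N * j := by exact_mod_cast h2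
  have h5 : c - 2 ^ N * j < (a : ℤ) + 1 := by exact_mod_cast h3
  omega

theorem IsThompsonHomeo.exists_good_level {f : UnitAddCircle ≃ₜ UnitAddCircle}
    (hf : IsThompsonHomeo f) : ∃ N : ℕ, ∀ a < 2 ^ N, IsGood f N a := by
  obtain ⟨N, hN⟩ := hf.exists_affine_level
  have h1 : ∀ a ∈ Finset.range (2 ^ N), ∀ᶠ j : ℕ in Filter.atTop,
      ∀ r < 2 ^ j, IsGood f (N + j) (2 ^ j * a + r) := by
    intro a _
    obtain ⟨k, hk⟩ := hN a
    obtain ⟨d, M, hd⟩ := (hf.1 (dyadic N a)).2 (isDyadicPoint_coe.2 (isDyadicReal_dyadic N a))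
    -- The pieces have images of length `1 / 2 ^ m` with `m = N + j - k`. The bound on `j` gives `m
    -- ≥ M`, so the image `d / 2 ^ M` of the left end is a multiple of `1 / 2 ^ m` and each piece
    -- lands on a standard interval.
    filter_upwards [Filter.eventually_ge_atTop (M + k.natAbs)] with j hj r hr
    obtain ⟨m, hm⟩ : ∃ m : ℕ, (N + j : ℤ) - k = m := ⟨((N + j : ℤ) - k).toNat, by omega⟩
    obtain ⟨e, rfl⟩ : ∃ e, m = M + e := Nat.exists_eq_add_of_le (by omega)
    refine isGood_of_int (m := M + e) (d * 2 ^ e + r) fun t ht => ?_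
    have hr' : (r : ℝ) + 1 ≤ 2 ^ j := by exact_mod_cast hr
    have hx := hk (((2 ^ j * a + r : ℕ) + t) / 2 ^ (N + j)) (by
      unfold dyadic
      have hj0 : (0 : ℝ) < 2 ^ j := by positivity
      have hN0 : (0 : ℝ) < 2 ^ N := by positivity
      have e1 : (((2 ^ j * a + r : ℕ) : ℝ) + t) / 2 ^ (N + j) =
          (a + (r + t) / 2 ^ j) / 2 ^ N := by
        push_cast
        field_simp
        ring
      have h0 : 0 ≤ ((r : ℝ) + t) / 2 ^ j := div_nonneg (by linarith [ht.1, (Nat.cast_nonneg r : (0 : ℝ) ≤ r)]) hj0.le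
      have h1 : ((r : ℝ) + t) / 2 ^ j ≤ 1 := (div_le_one hj0).2 (by linarith [ht.2])
      rw [e1]
      push_cast
      constructor
      · gcongr
        linarith
      · gcongr)
    rw [hx, hd, ← AddCircle.coe_add]
    congr 1
    have hk2 : (2 : ℝ) ^ k = 2 ^ (N + j) / 2 ^ (M + e) := by
      have : k = ((N + j : ℕ) : ℤ) - ((M + e : ℕ) : ℤ) := by push_cast at hm ⊢; omega
      rw [this, zpow_sub₀ (by norm_num), zpow_natCast, zpow_natCast]
    rw [hk2]
    unfold dyadic
    push_cast
    field_simp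
    ring
  obtain ⟨j, hj⟩ := ((Filter.eventually_all_finset _).2 h1).exists
  refine ⟨N + j, fun a ha => ?_⟩
  have := hj (a / 2 ^ j) (by
    rw [Finset.mem_range, Nat.div_lt_iff_lt_mul (by positivity), ← pow_add]
    exact ha) (a % 2 ^ j) (Nat.mod_lt _ (by positivity))
  rwa [Nat.div_add_mod] at this

/-! ### Leaf intervals of full binary trees -/

theorem leafIntervals_length (t : BinaryTree Unit) (a b : ℝ) :
    (leafIntervals t a b).length = t.numLeaves := by
  induction t generalizing a b with
  | nil => rfl
  | node _ l r hl hr => simp [leafIntervals, BinaryTree.numLeaves, hl, hr]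

theorem getElem?_node_left (l r : BinaryTree Unit) (u : Unit) (a b : ℝ) {i : ℕ}
    (h : i < l.numLeaves) : (leafIntervals (.node u l r) a b)[i]? =
      (leafIntervals l a ((a + b) / 2))[i]? :=
  List.getElem?_append_left (by rwa [leafIntervals_length])

theorem getElem?_node_right (l r : BinaryTree Unit) (u : Unit) (a b : ℝ) {i : ℕ}
    (h : l.numLeaves ≤ i) : (leafIntervals (.node u l r) a b)[i]? =
      (leafIntervals r ((a + b) / 2) b)[i - l.numLeaves]? := by
  rw [leafIntervals, List.getElem?_append_right (by rwa [leafIntervals_length]),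
    leafIntervals_length]

theorem lt_numLeaves_of_getElem? {t : BinaryTree Unit} {a b : ℝ} {i : ℕ} {p : ℝ × ℝ}
    (h : (leafIntervals t a b)[i]? = some p) : i < t.numLeaves := by
  rw [← leafIntervals_length t a b]
  exact (List.getElem?_eq_some_iff.1 h).1

theorem exists_getElem? (t : BinaryTree Unit) (a b : ℝ) {i : ℕ} (h : i < t.numLeaves) :
    ∃ p, (leafIntervals t a b)[i]? = some p := by
  rw [← leafIntervals_length t a b] at h
  exact ⟨_, List.getElem?_eq_getElem h⟩

theorem leafIntervals_first (t : BinaryTree Unit) (a b : ℝ) :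
    ∃ y, (leafIntervals t a b)[0]? = some (a, y) := by
  induction t generalizing a b with
  | nil => exact ⟨b, rfl⟩
  | node _ l r hl _ =>
    rw [getElem?_node_left _ _ _ _ _ l.numLeaves_pos]
    exact hl _ _

theorem leafIntervals_last (t : BinaryTree Unit) (a b : ℝ) :
    ∃ x, (leafIntervals t a b)[t.numLeaves - 1]? = some (x, b) := by
  induction t generalizing a b with
  | nil => exact ⟨a, rfl⟩
  | node _ l r _ hr =>
    have := r.numLeaves_pos
    simp only [BinaryTree.numLeaves]
    rw [getElem?_node_right _ _ _ _ _ (by omega),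
      show l.numLeaves + r.numLeaves - 1 - l.numLeaves = r.numLeaves - 1 by omega]
    exact hr _ _

theorem leafIntervals_adjacent {t : BinaryTree Unit} {a b : ℝ} {i : ℕ} {p q : ℝ × ℝ}
    (hp : (leafIntervals t a b)[i]? = some p) (hq : (leafIntervals t a b)[i + 1]? = some q) :
    p.2 = q.1 := by
  induction t generalizing a b i with
  | nil => simp [leafIntervals] at hq
  | node _ l r hl hr =>
    rcases lt_trichotomy (i + 1) l.numLeaves with h | h | h
    · rw [getElem?_node_left _ _ _ _ _ (by omega)] at hp hq
      exact hl hp hq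
    · rw [getElem?_node_left _ _ _ _ _ (by omega)] at hp
      rw [getElem?_node_right _ _ _ _ _ (by omega), h, Nat.sub_self] at hq
      obtain ⟨x, hx⟩ := leafIntervals_last l a ((a + b) / 2)
      obtain ⟨y, hy⟩ := leafIntervals_first r ((a + b) / 2) b
      rw [show l.numLeaves - 1 = i by omega, hp] at hx
      rw [hq] at hy
      cases hx
      cases hy
      rfl
    · rw [getElem?_node_right _ _ _ _ _ (by omega)] at hp hq
      rw [show i + 1 - l.numLeaves = i - l.numLeaves + 1 by omega] at hq
      exact hr hp hq

theorem leafIntervals_bounds {t : BinaryTree Unit} {a b : ℝ} (hab : a < b) {p : ℝ × ℝ}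
    (hp : p ∈ leafIntervals t a b) : a ≤ p.1 ∧ p.1 < p.2 ∧ p.2 ≤ b := by
  induction t generalizing a b with
  | nil =>
    simp only [leafIntervals, List.mem_singleton] at hp
    subst hp
    exact ⟨le_rfl, hab, le_rfl⟩
  | node _ l r hl hr =>
    rcases List.mem_append.1 hp with h | h
    · have := hl (by linarith) h
      exact ⟨this.1, this.2.1, by linarith⟩
    · have := hr (by linarith) h
      exact ⟨by linarith, this.2.1, this.2.2⟩

theorem leafIntervals_pairwise (t : BinaryTree Unit) {a b : ℝ} (hab : a < b) :
    (leafIntervals t a b).Pairwise fun p q => p.1 < q.1 := by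
  induction t generalizing a b with
  | nil => simp [leafIntervals]
  | node _ l r hl hr =>
    refine List.pairwise_append.2 ⟨hl (by linarith), hr (by linarith), fun p hp q hq => ?_⟩
    have h1 := leafIntervals_bounds (by linarith) hp
    have h2 := leafIntervals_bounds (by linarith) hq
    linarith

theorem leafIntervals_index_unique {t : BinaryTree Unit} {a b : ℝ} (hab : a < b) {i j : ℕ}
    {p q : ℝ × ℝ} (hp : (leafIntervals t a b)[i]? = some p)
    (hq : (leafIntervals t a b)[j]? = some q) (h : p.1 = q.1) : i = j := by
  obtain ⟨hi, rfl⟩ := List.getElem?_eq_some_iff.1 hp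
  obtain ⟨hj, rfl⟩ := List.getElem?_eq_some_iff.1 hq
  have := List.pairwise_iff_getElem.1 (leafIntervals_pairwise t hab)
  rcases lt_trichotomy i j with hij | hij | hij
  · exact absurd h (this i j hi hj hij).ne
  · exact hij
  · exact absurd h (this j i hj hi hij).ne'

theorem leafIntervals_cover (t : BinaryTree Unit) {a b x : ℝ} (ha : a ≤ x) (hb : x < b) :
    ∃ p ∈ leafIntervals t a b, p.1 ≤ x ∧ x < p.2 := by
  induction t generalizing a b with
  | nil => exact ⟨(a, b), by simp [leafIntervals], ha, hb⟩
  | node _ l r hl hr =>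
    rcases lt_or_ge x ((a + b) / 2) with h | h
    · obtain ⟨p, hp, h'⟩ := hl ha h
      exact ⟨p, List.mem_append_left _ hp, h'⟩
    · obtain ⟨p, hp, h'⟩ := hr h hb
      exact ⟨p, List.mem_append_right _ hp, h'⟩

/-- The leaf intervals of a tree whose root carries `[a / 2 ^ n, (a + 1) / 2 ^ n]`. -/
noncomputable def dyadicLeaves (t : BinaryTree Unit) (n a : ℕ) : List (ℝ × ℝ) :=
  leafIntervals t (dyadic n a) (dyadic n (a + 1))

theorem leafIntervals_zero_one (t : BinaryTree Unit) : leafIntervals t 0 1 = dyadicLeaves t 0 0 := by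
  simp [dyadicLeaves, dyadic]

theorem dyadicLeaves_first (t : BinaryTree Unit) (n a : ℕ) :
    ∃ y, (dyadicLeaves t n a)[0]? = some (dyadic n a, y) :=
  leafIntervals_first _ _ _

theorem dyadicLeaves_node (u : Unit) (l r : BinaryTree Unit) (n a : ℕ) :
    dyadicLeaves (.node u l r) n a =
      dyadicLeaves l (n + 1) (2 * a) ++ dyadicLeaves r (n + 1) (2 * a + 1) := by
  unfold dyadicLeaves
  rw [leafIntervals, show 2 * a + 1 + 1 = 2 * (a + 1) by ring, dyadic_succ_double,
    dyadic_succ_double, dyadic_succ_double_add_one]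

theorem dyadicLeaves_node_left (u : Unit) (l r : BinaryTree Unit) (n a : ℕ) {i : ℕ}
    (h : i < l.numLeaves) :
    (dyadicLeaves (.node u l r) n a)[i]? = (dyadicLeaves l (n + 1) (2 * a))[i]? := by
  rw [dyadicLeaves_node]
  exact List.getElem?_append_left (by rwa [dyadicLeaves, leafIntervals_length])

theorem dyadicLeaves_node_right (u : Unit) (l r : BinaryTree Unit) (n a : ℕ) {i : ℕ}
    (h : l.numLeaves ≤ i) : (dyadicLeaves (.node u l r) n a)[i]? =
      (dyadicLeaves r (n + 1) (2 * a + 1))[i - l.numLeaves]? := by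
  rw [dyadicLeaves_node,
    List.getElem?_append_right (by rwa [dyadicLeaves, leafIntervals_length])]
  congr 2
  exact leafIntervals_length _ _ _

theorem mem_dyadicLeaves {t : BinaryTree Unit} {n a : ℕ} (ha : a < 2 ^ n) {p : ℝ × ℝ}
    (hp : p ∈ dyadicLeaves t n a) : ∃ m b, b < 2 ^ m ∧ p = (dyadic m b, dyadic m (b + 1)) := by
  induction t generalizing n a with
  | nil =>
    simp only [dyadicLeaves, leafIntervals, List.mem_singleton] at hp
    exact ⟨n, a, ha, hp⟩
  | node _ l r hl hr =>
    rw [dyadicLeaves_node] at hp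
    rcases List.mem_append.1 hp with h | h
    · exact hl (by rw [pow_succ]; omega) h
    · exact hr (by rw [pow_succ]; omega) h

theorem eq_dyadic_of_getElem? {t : BinaryTree Unit} {i : ℕ} {p : ℝ × ℝ}
    (hp : (leafIntervals t 0 1)[i]? = some p) :
    ∃ m b, b < 2 ^ m ∧ p = (dyadic m b, dyadic m (b + 1)) := by
  rw [leafIntervals_zero_one] at hp
  exact mem_dyadicLeaves (by norm_num) (List.mem_of_getElem? hp)

theorem IsCaretAt.exists_leaves {t : BinaryTree Unit} {i n a : ℕ} (h : IsCaretAt t i)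
    (ha : a < 2 ^ n) : ∃ m b, b < 2 ^ m ∧
      (dyadicLeaves t n a)[i]? = some (dyadic (m + 1) (2 * b), dyadic (m + 1) (2 * b + 1)) ∧
      (dyadicLeaves t n a)[i + 1]? =
        some (dyadic (m + 1) (2 * b + 1), dyadic (m + 1) (2 * b + 2)) := by
  induction t generalizing i n a with
  | nil => exact h.elim
  | node _ l r hl hr =>
    rcases h with ⟨rfl, rfl, rfl⟩ | h | ⟨h', h⟩
    · refine ⟨n, a, ha, ?_, ?_⟩ <;> rw [dyadicLeaves_node] <;>
        simp [dyadicLeaves, leafIntervals, add_assoc]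
    · obtain ⟨m, b, hb, h1, h2⟩ := hl h (n := n + 1) (a := 2 * a) (by rw [pow_succ]; omega)
      refine ⟨m, b, hb, ?_, ?_⟩
      · rw [dyadicLeaves_node_left _ _ _ _ _ (lt_numLeaves_of_getElem? h1), h1]
      · rw [dyadicLeaves_node_left _ _ _ _ _ (lt_numLeaves_of_getElem? h2), h2]
    · obtain ⟨m, b, hb, h1, h2⟩ := hr h (n := n + 1) (a := 2 * a + 1) (by rw [pow_succ]; omega)
      refine ⟨m, b, hb, ?_, ?_⟩
      · rw [dyadicLeaves_node_right _ _ _ _ _ h', h1]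
      · rw [dyadicLeaves_node_right _ _ _ _ _ (by omega), ← h2]
        congr 1
        omega

/-! ### Colourings of Thompson graphs -/

theorem digitParity_dyadic_succ_double_add_one (n a : ℕ) :
    digitParity (dyadic (n + 1) (2 * a + 1)) = digitParity (dyadic n a) + 1 := by
  have := digitParity_double_succ a n
  simpa [dyadic] using this

/-- The right child of a vertex starts at the midpoint of its interval, whose expansion is that of
the left end with a digit 1 appended. -/
theorem ThompsonEdge.exists_leaves {t : BinaryTree Unit} {i j n a : ℕ} (h : ThompsonEdge t i j) :
    ∃ p q, (dyadicLeaves t n a)[i]? = some p ∧ (dyadicLeaves t n a)[j]? = some q ∧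
      digitParity q.1 = digitParity p.1 + 1 := by
  induction t generalizing i j n a with
  | nil => exact h.elim
  | node _ l r hl hr =>
    rcases h with ⟨rfl, rfl⟩ | h | ⟨hi, hj, h⟩
    · obtain ⟨y, hy⟩ := dyadicLeaves_first l (n + 1) (2 * a)
      obtain ⟨z, hz⟩ := dyadicLeaves_first r (n + 1) (2 * a + 1)
      rw [← dyadicLeaves_node_left () l r n a l.numLeaves_pos] at hy
      rw [← l.numLeaves.sub_self, ← dyadicLeaves_node_right () l r n a le_rfl] at hz
      refine ⟨_, _, hy, hz, ?_⟩
      rw [digitParity_dyadic_succ_double_add_one, dyadic_succ_double]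
    · obtain ⟨p, q, h1, h2, h3⟩ := hl h (n := n + 1) (a := 2 * a)
      refine ⟨p, q, ?_, ?_, h3⟩
      · rw [dyadicLeaves_node_left _ _ _ _ _ (lt_numLeaves_of_getElem? h1), h1]
      · rw [dyadicLeaves_node_left _ _ _ _ _ (lt_numLeaves_of_getElem? h2), h2]
    · obtain ⟨p, q, h1, h2, h3⟩ := hr h (n := n + 1) (a := 2 * a + 1)
      refine ⟨p, q, ?_, ?_, h3⟩
      · rw [dyadicLeaves_node_right _ _ _ _ _ hi, h1]
      · rw [dyadicLeaves_node_right _ _ _ _ _ hj, h2]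

/-- The graph is connected: the edge at the root links the graphs of the two subtrees through their
first vertices. So a 2-colouring is determined by its value at vertex 0. -/
theorem coloring_eq_digitParity {t : BinaryTree Unit} {n a : ℕ} {c : ℕ → ZMod 2}
    (hc : ∀ i j, ThompsonEdge t i j → c j = c i + 1) {i : ℕ} {p : ℝ × ℝ}
    (hp : (dyadicLeaves t n a)[i]? = some p) :
    c i = c 0 + digitParity p.1 - digitParity (dyadic n a) := by
  induction t generalizing n a c i with
  | nil =>
    obtain rfl : i = 0 := by
      have := lt_numLeaves_of_getElem? hp
      simp only [BinaryTree.numLeaves] at this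
      omega
    simp only [dyadicLeaves, leafIntervals, List.getElem?_cons_zero, Option.some.injEq] at hp
    subst hp
    simp
  | node _ l r hl hr =>
    rcases lt_or_ge i l.numLeaves with h | h
    · rw [dyadicLeaves_node_left _ _ _ _ _ h] at hp
      rw [hl (fun i j hij => hc i j (Or.inr (Or.inl hij))) hp, dyadic_succ_double]
    · rw [dyadicLeaves_node_right _ _ _ _ _ h] at hp
      have h1 := hr (c := fun k => c (k + l.numLeaves)) (fun i j hij => hc _ _
        (Or.inr (Or.inr ⟨by omega, by omega, by simpa using hij⟩))) hp
      beta_reduce at h1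
      rw [Nat.sub_add_cancel h, zero_add, digitParity_dyadic_succ_double_add_one,
        hc 0 l.numLeaves (Or.inl ⟨rfl, rfl⟩)] at h1
      rw [h1]
      ring

/-! ### The tree of maximal good intervals -/

open scoped Classical in
/-- The tree, below the vertex carrying `[a / 2 ^ n, (a + 1) / 2 ^ n]` and of height at most `d`,
obtained by splitting the intervals that fail to satisfy `G`. -/
noncomputable def splitTree (G : ℕ → ℕ → Prop) : ℕ → ℕ → ℕ → BinaryTree Unit
  | 0, _, _ => .nil
  | d + 1, n, a => if G n a then .nil else
      .node () (splitTree G d (n + 1) (2 * a)) (splitTree G d (n + 1) (2 * a + 1))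

/-- The interval satisfies `G` and is the unit interval or half of an interval failing `G`. -/
def IsMaximalFor (G : ℕ → ℕ → Prop) (n a : ℕ) : Prop :=
  G n a ∧ ∀ m, n = m + 1 → ¬ G m (a / 2)

/-- Splitting happens only at failing intervals, so the parent of a leaf other than the root fails
`G`; `hn` supplies this for the root of the subtree, and `hG` makes the leaves cut off at full depth
satisfy `G`. -/
theorem mem_splitTree {G : ℕ → ℕ → Prop} {d n a : ℕ} (ha : a < 2 ^ n)
    (hG : ∀ b < 2 ^ (n + d), G (n + d) b) (hn : ∀ m, n = m + 1 → ¬ G m (a / 2)) {p : ℝ × ℝ}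
    (hp : p ∈ dyadicLeaves (splitTree G d n a) n a) :
    ∃ m b, b < 2 ^ m ∧ IsMaximalFor G m b ∧ p = (dyadic m b, dyadic m (b + 1)) := by
  induction d generalizing n a with
  | zero =>
    simp only [splitTree, dyadicLeaves, leafIntervals, List.mem_singleton] at hp
    exact ⟨n, a, ha, ⟨hG a ha, hn⟩, hp⟩
  | succ d ih =>
    rw [splitTree] at hp
    split_ifs at hp with h
    · simp only [dyadicLeaves, leafIntervals, List.mem_singleton] at hp
      exact ⟨n, a, ha, ⟨h, hn⟩, hp⟩
    · rw [dyadicLeaves_node] at hp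
      rw [show n + (d + 1) = n + 1 + d by ring] at hG
      rcases List.mem_append.1 hp with hp | hp
      · refine ih (by rw [pow_succ]; omega) hG (fun m hm => ?_) hp
        obtain rfl : n = m := by omega
        rwa [show 2 * a / 2 = a by omega]
      · refine ih (by rw [pow_succ]; omega) hG (fun m hm => ?_) hp
        obtain rfl : n = m := by omega
        rwa [show (2 * a + 1) / 2 = a by omega]

theorem descendant_of_hereditary {G : ℕ → ℕ → Prop}
    (hG : ∀ n a, G n a → G (n + 1) (2 * a) ∧ G (n + 1) (2 * a + 1)) {n a : ℕ} (h : G n a) (e b : ℕ)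
    (hb : b / 2 ^ e = a) : G (n + e) b := by
  induction e generalizing b with
  | zero => simpa [← hb] using h
  | succ e ih =>
    have h1 := hG _ _ (ih (b / 2) (by rw [Nat.div_div_eq_div_mul, ← pow_succ', hb]))
    rcases Nat.even_or_odd' b with ⟨k, rfl | rfl⟩
    · rw [show 2 * k / 2 = k by omega] at h1
      exact h1.1
    · rw [show (2 * k + 1) / 2 = k by omega] at h1
      exact h1.2

theorem splitTree_mem {G : ℕ → ℕ → Prop}
    (hG : ∀ n a, G n a → G (n + 1) (2 * a) ∧ G (n + 1) (2 * a + 1)) {d n a : ℕ} (ha : a < 2 ^ n)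
    (hd : ∀ b < 2 ^ (n + d), G (n + d) b) {e b : ℕ} (hb : b / 2 ^ e = a)
    (hmax : IsMaximalFor G (n + e) b) :
    (dyadic (n + e) b, dyadic (n + e) (b + 1)) ∈ dyadicLeaves (splitTree G d n a) n a := by
  -- If the vertex itself satisfies `G`, so does every descendant, and a strict descendant could not
  -- be maximal. Here `b / 2 ^ e` is the ancestor of `b` that lies `e` levels up.
  have key : G n a → e = 0 := by
    intro h
    by_contra he
    obtain ⟨e, rfl⟩ := Nat.exists_eq_succ_of_ne_zero he
    refine hmax.2 (n + e) (by omega) (descendant_of_hereditary hG h e (b / 2) ?_)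
    rw [Nat.div_div_eq_div_mul, ← pow_succ', hb]
  induction d generalizing n a e with
  | zero =>
    obtain rfl := key (hd a ha)
    simp at hb
    subst hb
    simp [splitTree, dyadicLeaves, leafIntervals]
  | succ d ih =>
    rw [splitTree]
    split_ifs with h
    · obtain rfl := key h
      simp at hb
      subst hb
      simp [dyadicLeaves, leafIntervals]
    · have he : e ≠ 0 := by
        rintro rfl
        simp at hb
        subst hb
        exact h hmax.1
      obtain ⟨e, rfl⟩ := Nat.exists_eq_succ_of_ne_zero he
      rw [show n + (d + 1) = n + 1 + d by ring] at hd
      rw [Nat.succ_eq_add_one, show n + (e + 1) = n + 1 + e by ring] at hmax ⊢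
      rw [Nat.succ_eq_add_one, pow_succ, ← Nat.div_div_eq_div_mul] at hb
      have key' : G (n + 1) (b / 2 ^ e) → e = 0 := by
        intro h
        by_contra he
        obtain ⟨e, rfl⟩ := Nat.exists_eq_succ_of_ne_zero he
        refine hmax.2 (n + 1 + e) (by omega) (descendant_of_hereditary hG h e (b / 2) ?_)
        rw [Nat.div_div_eq_div_mul, ← pow_succ']
      rw [dyadicLeaves_node, List.mem_append]
      rcases Nat.even_or_odd' (b / 2 ^ e) with ⟨k, hk | hk⟩
      · have hka : b / 2 ^ e = 2 * a := by omega
        exact Or.inl (ih (by rw [pow_succ]; omega) hd hka hmax (by rwa [hka] at key'))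
      · have hka : b / 2 ^ e = 2 * a + 1 := by omega
        exact Or.inr (ih (by rw [pow_succ]; omega) hd hka hmax (by rwa [hka] at key'))

theorem mem_splitTree_root {G : ℕ → ℕ → Prop}
    (hG : ∀ n a, G n a → G (n + 1) (2 * a) ∧ G (n + 1) (2 * a + 1)) {d : ℕ}
    (hd : ∀ b < 2 ^ d, G d b) (p : ℝ × ℝ) : p ∈ leafIntervals (splitTree G d 0 0) 0 1 ↔
      ∃ m b, b < 2 ^ m ∧ IsMaximalFor G m b ∧ p = (dyadic m b, dyadic m (b + 1)) := by
  rw [leafIntervals_zero_one]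
  constructor
  · exact mem_splitTree (by norm_num) (by simpa using hd) (by simp)
  · rintro ⟨m, b, hb, hmax, rfl⟩
    have := splitTree_mem hG (d := d) (n := 0) (a := 0) (by norm_num) (by simpa using hd)
      (Nat.div_eq_of_lt hb) (by simpa using hmax)
    simpa using this

/-! ### Reduced pairs of trees -/

theorem MapsAffinely.unique {f : UnitAddCircle → UnitAddCircle} {x y : ℝ} {m b m' b' : ℕ}
    (h : MapsAffinely f x y (dyadic m b) (dyadic m (b + 1)))
    (h' : MapsAffinely f x y (dyadic m' b') (dyadic m' (b' + 1))) (hb : b < 2 ^ m)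
    (hb' : b' < 2 ^ m') : m = m' ∧ b = b' := by
  have e1 := coe_inj_of_mem_Ico (dyadic_nonneg m b) (dyadic_lt_one hb) (dyadic_nonneg m' b')
    (dyadic_lt_one hb') (h.map_left.symm.trans h'.map_left)
  -- Midpoints are compared instead of right ends: a right end may equal 1, which is identified with
  -- 0 on the circle.
  have e2 := h.left.map_right.symm.trans h'.left.map_right
  rw [← dyadic_succ_double_add_one, ← dyadic_succ_double_add_one] at e2
  have e3 := coe_inj_of_mem_Ico (dyadic_nonneg _ _) (dyadic_lt_one (by rw [pow_succ]; omega))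
    (dyadic_nonneg _ _) (dyadic_lt_one (by rw [pow_succ]; omega)) e2
  rw [dyadic_succ_double_add_one, dyadic_succ_double_add_one] at e3
  exact dyadic_interval_inj e1 (by linarith)

/-- If the parent of the image interval were good for the inverse, its preimage would be a standard
interval having the original one as a half. It would thus be the parent of the original interval,
and good for `f`. -/
theorem IsMaximalFor.exists_image {f : UnitAddCircle ≃ₜ UnitAddCircle} {n a : ℕ}
    (h : IsMaximalFor (IsGood f) n a) (ha : a < 2 ^ n) :
    ∃ m b, b < 2 ^ m ∧ IsMaximalFor (IsGood f.symm) m b ∧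
      MapsAffinely f (dyadic n a) (dyadic n (a + 1)) (dyadic m b) (dyadic m (b + 1)) := by
  obtain ⟨⟨m, b, hb, hf⟩, hmax⟩ := h
  refine ⟨m, b, hb, ⟨⟨n, a, ha, hf.symm⟩, ?_⟩, hf⟩
  rintro m rfl ⟨n', a', ha', hg⟩
  have hg' : MapsAffinely f (dyadic n' a') (dyadic n' (a' + 1)) (dyadic m (b / 2))
      (dyadic m (b / 2 + 1)) := hg.symm
  have key : n = n' + 1 ∧ a / 2 = a' := by
    rcases Nat.even_or_odd' b with ⟨k, rfl | rfl⟩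
    · rw [show 2 * k / 2 = k by omega] at hg
      have := hf.symm.unique hg.dyadic_left ha (by rw [pow_succ]; omega)
      omega
    · rw [show (2 * k + 1) / 2 = k by omega] at hg
      have := hf.symm.unique hg.dyadic_right ha (by rw [pow_succ]; omega)
      omega
  obtain ⟨rfl, rfl⟩ := key
  exact hmax n' rfl ⟨m, b / 2, by rw [pow_succ] at hb; omega, hg'⟩

theorem leafIntervals_unit_bounds {t : BinaryTree Unit} {i : ℕ} {p : ℝ × ℝ}
    (hp : (leafIntervals t 0 1)[i]? = some p) : 0 ≤ p.1 ∧ p.1 < 1 := by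
  have := leafIntervals_bounds one_pos (List.mem_of_getElem? hp)
  exact ⟨this.1, by linarith⟩

/-- Adjacent leaves share an end point, so their images are adjacent on the circle; a leaf of `S` is
determined by its left end. Induction along `R` therefore gives a cyclic shift. -/
theorem exists_cyclic_shift {f : UnitAddCircle ≃ₜ UnitAddCircle} {R S : BinaryTree Unit}
    (h : ∀ p ∈ leafIntervals R 0 1, ∃ q ∈ leafIntervals S 0 1, MapsAffinely f p.1 p.2 q.1 q.2) :
    ∃ s < S.numLeaves, ∀ i p, (leafIntervals R 0 1)[i]? = some p →
      ∃ q, (leafIntervals S 0 1)[(i + s) % S.numLeaves]? = some q ∧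
        MapsAffinely f p.1 p.2 q.1 q.2 := by
  obtain ⟨y, hy⟩ := leafIntervals_first R 0 1
  obtain ⟨q, hq, hf⟩ := h _ (List.mem_of_getElem? hy)
  obtain ⟨s, hs⟩ := List.mem_iff_getElem?.1 hq
  have hs' := lt_numLeaves_of_getElem? hs
  refine ⟨s, hs', fun i => ?_⟩
  induction i with
  | zero =>
    intro p hp
    rw [hy] at hp
    cases hp
    exact ⟨q, by rwa [zero_add, Nat.mod_eq_of_lt hs'], hf⟩
  | succ i ih =>
    intro p hp
    obtain ⟨p₀, hp₀⟩ := exists_getElem? R 0 1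
      (show i < R.numLeaves by have := lt_numLeaves_of_getElem? hp; omega)
    obtain ⟨q₀, hq₀, hf₀⟩ := ih p₀ hp₀
    obtain ⟨q', hq', hf'⟩ := h p (List.mem_of_getElem? hp)
    obtain ⟨j, hj⟩ := List.mem_iff_getElem?.1 hq'
    have e1 : (q'.1 : UnitAddCircle) = q₀.2 := by
      rw [← hf'.map_left, ← hf₀.map_right, leafIntervals_adjacent hp₀ hp]
    have hb := leafIntervals_unit_bounds hj
    have hk := Nat.mod_lt (i + s) S.numLeaves_pos
    have hmod : (i + 1 + s) % S.numLeaves = ((i + s) % S.numLeaves + 1) % S.numLeaves := by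
      rw [Nat.mod_add_mod, add_right_comm]
    refine ⟨q', ?_, hf'⟩
    rcases Nat.lt_or_ge ((i + s) % S.numLeaves + 1) S.numLeaves with hlt | hge
    · obtain ⟨q₁, hq₁⟩ := exists_getElem? S 0 1 hlt
      have hb₁ := leafIntervals_unit_bounds hq₁
      rw [leafIntervals_adjacent hq₀ hq₁] at e1
      have := leafIntervals_index_unique one_pos hj hq₁
        (coe_inj_of_mem_Ico hb.1 hb.2 hb₁.1 hb₁.2 e1)
      rw [hmod, Nat.mod_eq_of_lt hlt, ← this, hj]
    -- The previous image was the last leaf of `S`, ending at 1, so the next image starts at 0 and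
    -- is the first leaf.
    · obtain ⟨x, hx⟩ := leafIntervals_last S 0 1
      rw [show S.numLeaves - 1 = (i + s) % S.numLeaves by omega, hq₀] at hx
      cases hx
      obtain ⟨y, hy⟩ := leafIntervals_first S 0 1
      have e2 : (q'.1 : UnitAddCircle) = ((0 : ℝ) : UnitAddCircle) := by
        rw [e1]
        exact unitAddCircle_coe_eq_iff.2 ⟨-1, by norm_num⟩
      have := leafIntervals_index_unique one_pos hj hy
        (coe_inj_of_mem_Ico hb.1 hb.2 le_rfl one_pos e2)
      rw [hmod, show (i + s) % S.numLeaves + 1 = S.numLeaves by omega, Nat.mod_self, ← this, hj]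

/-- With more leaves in `R`, leaf 0 and leaf `S.numLeaves` would be shifted to the same leaf of `S`,
against injectivity. -/
theorem numLeaves_le_of_maps {f : UnitAddCircle ≃ₜ UnitAddCircle} {R S : BinaryTree Unit}
    (h : ∀ p ∈ leafIntervals R 0 1, ∃ q ∈ leafIntervals S 0 1, MapsAffinely f p.1 p.2 q.1 q.2) :
    R.numLeaves ≤ S.numLeaves := by
  by_contra! hlt
  obtain ⟨s, -, hs⟩ := exists_cyclic_shift h
  obtain ⟨p, hp⟩ := exists_getElem? R 0 1 R.numLeaves_pos
  obtain ⟨p', hp'⟩ := exists_getElem? R 0 1 hlt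
  obtain ⟨q, hq, hf⟩ := hs _ _ hp
  obtain ⟨q', hq', hf'⟩ := hs _ _ hp'
  rw [Nat.add_mod_left] at hq'
  rw [zero_add, hq'] at hq
  cases hq
  have e := f.injective (hf.map_left.trans hf'.map_left.symm)
  have hb := leafIntervals_unit_bounds hp
  have hb' := leafIntervals_unit_bounds hp'
  have := leafIntervals_index_unique one_pos hp hp' (coe_inj_of_mem_Ico hb.1 hb.2 hb'.1 hb'.2 e)
  have := S.numLeaves_pos
  omega

theorem isGood_hereditary (f : UnitAddCircle → UnitAddCircle) (n a : ℕ) (h : IsGood f n a) :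
    IsGood f (n + 1) (2 * a) ∧ IsGood f (n + 1) (2 * a + 1) :=
  ⟨h.double, h.double_add_one⟩

theorem splitTree_maps {f : UnitAddCircle ≃ₜ UnitAddCircle} {d e : ℕ}
    (hd : ∀ a < 2 ^ d, IsGood f d a) (he : ∀ a < 2 ^ e, IsGood f.symm e a) :
    ∀ p ∈ leafIntervals (splitTree (IsGood f) d 0 0) 0 1,
      ∃ q ∈ leafIntervals (splitTree (IsGood f.symm) e 0 0) 0 1,
        MapsAffinely f p.1 p.2 q.1 q.2 := by
  intro p hp
  obtain ⟨n, a, ha, hmax, rfl⟩ := (mem_splitTree_root (isGood_hereditary f) hd p).1 hp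
  obtain ⟨m, b, hb, hmax', hf⟩ := hmax.exists_image ha
  exact ⟨_, (mem_splitTree_root (isGood_hereditary f.symm) he _).2 ⟨m, b, hb, hmax', rfl⟩, hf⟩

theorem IsThompsonHomeo.exists_reduced {f : UnitAddCircle ≃ₜ UnitAddCircle}
    (hf : IsThompsonHomeo f) : ∃ P : TreePair, P.IsReduced ∧
      ∀ i p q, (leafIntervals P.input 0 1)[i]? = some p →
        (leafIntervals P.output 0 1)[P.partner i]? = some q → MapsAffinely f p.1 p.2 q.1 q.2 := by
  obtain ⟨d, hd⟩ := hf.exists_good_level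
  have hf' : IsThompsonHomeo f.symm := ThompsonT.inv_mem (x := f) hf
  obtain ⟨e, he⟩ := hf'.exists_good_level
  have h := splitTree_maps hd he
  have hR := mem_splitTree_root (isGood_hereditary f) hd
  have hcard : (splitTree (IsGood f.symm) e 0 0).numLeaves =
      (splitTree (IsGood f) d 0 0).numLeaves := le_antisymm (numLeaves_le_of_maps (splitTree_maps (f := f.symm) he hd))
    (numLeaves_le_of_maps h)
  obtain ⟨s, hs, hs'⟩ := exists_cyclic_shift h
  generalize splitTree (IsGood f) d 0 0 = R at *
  generalize splitTree (IsGood f.symm) e 0 0 = S at *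
  have hmap : ∀ i p q, (leafIntervals R 0 1)[i]? = some p →
      (leafIntervals S 0 1)[(i + s) % R.numLeaves]? = some q → MapsAffinely f p.1 p.2 q.1 q.2 := by
    intro i p q hp hq
    obtain ⟨q', hq', h⟩ := hs' i p hp
    rw [hcard, hq] at hq'
    cases hq'
    exact h
  refine ⟨⟨R, S, hcard, s, hcard ▸ hs⟩, ?_, hmap⟩
  rintro i ⟨hRi, hSi⟩
  change IsCaretAt S ((i + s) % R.numLeaves) at hSi
  obtain ⟨n, a, ha, h1, h2⟩ := hRi.exists_leaves (n := 0) (a := 0) (by norm_num)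
  obtain ⟨m, b, hb, h3, h4⟩ := hSi.exists_leaves (n := 0) (a := 0) (by norm_num)
  rw [← leafIntervals_zero_one] at h1 h2 h3 h4
  -- The right leaf of the output caret exists, so the partner of `i + 1` is the partner of `i` plus
  -- one, without wrapping around.
  have hlt := lt_numLeaves_of_getElem? h4
  have h5 := hmap _ _ _ h1 h3
  have h6 := hmap _ _ _ h2 (by
    rw [← h4, add_right_comm, ← Nat.mod_add_mod, Nat.mod_eq_of_lt (hcard ▸ hlt)])
  have e2 : ∀ c, 2 * c + 2 = 2 * (c + 1) := fun c => by ring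
  simp only [e2, dyadic_succ_double, dyadic_succ_double_add_one] at h5 h6
  obtain ⟨n', a', -, hmax, hp⟩ := (hR _).1 (List.mem_of_getElem? h1)
  rw [Prod.mk.injEq] at hp
  obtain ⟨rfl, rfl⟩ := dyadic_interval_inj hp.1 (by rw [hp.1, hp.2])
  -- A removable caret would make the union of its two leaves good, against maximality of the left
  -- leaf.
  refine hmax.2 n rfl ?_
  rw [Nat.mul_div_cancel_left _ two_pos]
  exact ⟨m, b, hb, h5.glue h6⟩

/-! ### The Jones subgroup -/

/-- `f` preserves or reverses the parity of the binary digit sums of all dyadic points. -/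
def RespectsParity (f : UnitAddCircle → UnitAddCircle) : Prop :=
  ∃ ε : ZMod 2, ∀ x, IsDyadicPoint x → pointParity (f x) = pointParity x + ε

theorem ZMod.eq_add_one_of_ne {x y : ZMod 2} (h : x ≠ y) : y = x + 1 := by
  revert x y
  decide

theorem ThompsonEdge.lt_and_ne {t : BinaryTree Unit} {i j : ℕ} (h : ThompsonEdge t i j) :
    i < t.numLeaves ∧ j < t.numLeaves ∧ i ≠ j := by
  obtain ⟨p, q, hp, hq, hpq⟩ := h.exists_leaves (n := 0) (a := 0)
  refine ⟨lt_numLeaves_of_getElem? hp, lt_numLeaves_of_getElem? hq, ?_⟩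
  rintro rfl
  rw [hp] at hq
  cases hq
  simp at hpq

theorem TreePair.partner_lt (P : TreePair) (i : ℕ) : P.partner i < P.input.numLeaves :=
  Nat.mod_lt _ P.input.numLeaves_pos

/-- The number of the leaf of the input tree identified with leaf `j` of the output tree. -/
def TreePair.copartner (P : TreePair) (j : ℕ) : ℕ :=
  (j + (P.input.numLeaves - P.shift)) % P.input.numLeaves

theorem TreePair.copartner_lt (P : TreePair) (i : ℕ) : P.copartner i < P.input.numLeaves :=
  Nat.mod_lt _ P.input.numLeaves_pos

theorem TreePair.copartner_partner (P : TreePair) {i : ℕ} (h : i < P.input.numLeaves) :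
    P.copartner (P.partner i) = i := by
  have := P.shift_lt
  rw [copartner, partner, Nat.mod_add_mod, add_assoc, Nat.add_sub_cancel' this.le,
    Nat.add_mod_right, Nat.mod_eq_of_lt h]

theorem TreePair.partner_copartner (P : TreePair) {j : ℕ} (h : j < P.input.numLeaves) :
    P.partner (P.copartner j) = j := by
  have := P.shift_lt
  rw [copartner, partner, Nat.mod_add_mod, add_assoc, Nat.sub_add_cancel this.le,
    Nat.add_mod_right, Nat.mod_eq_of_lt h]

/-- A 2-colouring of the union restricts to the graph of each tree, where it is digit parity up to a
constant; `ε` is the discrepancy of the two constants. -/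
theorem TreePair.exists_parity_eq (P : TreePair) (h : P.thompsonGraph.IsBipartite) :
    ∃ ε : ZMod 2, ∀ i p q, (leafIntervals P.input 0 1)[i]? = some p →
      (leafIntervals P.output 0 1)[P.partner i]? = some q →
        digitParity q.1 = digitParity p.1 + ε := by
  obtain ⟨C⟩ := h
  let c : ℕ → ZMod 2 := fun i =>
    if hi : i < P.input.numLeaves then (C ⟨i, hi⟩ : Fin 2) else 0
  have hadj : ∀ i j, i < P.input.numLeaves → j < P.input.numLeaves → i ≠ j →
      ThompsonEdge P.input i j ∨ ThompsonEdge P.output (P.partner i) (P.partner j) →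
        c j = c i + 1 := by
    intro i j hi hj hij hE
    apply ZMod.eq_add_one_of_ne
    rw [show c i = C ⟨i, hi⟩ from dif_pos hi, show c j = C ⟨j, hj⟩ from dif_pos hj]
    apply C.valid
    rw [TreePair.thompsonGraph, SimpleGraph.fromRel_adj]
    exact ⟨by simpa using hij, Or.inl hE⟩
  have h1 : ∀ i j, ThompsonEdge P.input i j → c j = c i + 1 := fun i j hE =>
    hadj i j hE.lt_and_ne.1 hE.lt_and_ne.2.1 hE.lt_and_ne.2.2 (Or.inl hE)
  have h2 : ∀ i j, ThompsonEdge P.output i j → c (P.copartner j) = c (P.copartner i) + 1 := by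
    intro i j hE
    obtain ⟨hi, hj, hij⟩ := hE.lt_and_ne
    rw [P.numLeaves_eq] at hi hj
    refine hadj _ _ (P.copartner_lt i) (P.copartner_lt j) (fun e => hij ?_) (Or.inr ?_)
    · rw [← P.partner_copartner hi, e, P.partner_copartner hj]
    · rwa [P.partner_copartner hi, P.partner_copartner hj]
  refine ⟨c 0 - c (P.copartner 0), fun i p q hp hq => ?_⟩
  have hi := lt_numLeaves_of_getElem? hp
  rw [leafIntervals_zero_one] at hp hq
  have e1 := coloring_eq_digitParity h1 hp
  have e2 := coloring_eq_digitParity (c := fun j => c (P.copartner j)) h2 hq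
  beta_reduce at e2
  rw [P.copartner_partner hi, e1] at e2
  linear_combination -e2

theorem TreePair.Represents.respectsParity {P : TreePair} {f : UnitAddCircle → UnitAddCircle}
    (hP : P.Represents f) (h : P.thompsonGraph.IsBipartite) : RespectsParity f := by
  obtain ⟨ε, hε⟩ := P.exists_parity_eq h
  refine ⟨ε, fun x hx => ?_⟩
  obtain ⟨t, h0, h1, rfl⟩ := exists_coe_mem_Ico x
  rw [isDyadicPoint_coe] at hx
  obtain ⟨p, hp, hpt, htp⟩ := leafIntervals_cover P.input h0 h1
  obtain ⟨i, hi⟩ := List.mem_iff_getElem?.1 hp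
  obtain ⟨q, hq⟩ := exists_getElem? P.output 0 1
    (show P.partner i < P.output.numLeaves by rw [P.numLeaves_eq]; exact P.partner_lt i)
  have hf := hP i p.1 p.2 q.1 q.2 hi hq t ⟨hpt, htp⟩
  have e := hε i p q hi hq
  obtain ⟨n, a, -, rfl⟩ := eq_dyadic_of_getElem? hi
  obtain ⟨m, b, -, rfl⟩ := eq_dyadic_of_getElem? hq
  have hn : (0 : ℝ) < 2 ^ n := by positivity
  -- The relative position `u` of `t` in its leaf carries the digits that `f` leaves alone.
  obtain ⟨u, hu⟩ : ∃ u, u = 2 ^ n * (t - dyadic n a) := ⟨_, rfl⟩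
  have hsub := dyadic_sub n a
  have hu0 : 0 ≤ u := by
    rw [hu]
    exact mul_nonneg hn.le (sub_nonneg.2 hpt)
  have hu1 : u < 1 := by
    rw [hu, ← lt_div_iff₀' hn]
    linarith
  have hud : IsDyadicReal u := by
    rw [hu]
    refine IsDyadicReal.mul ?_ (hx.sub (isDyadicReal_dyadic n a))
    exact_mod_cast IsDyadicReal.natCast (2 ^ n)
  have ht : t = ((a : ℤ) + u) / 2 ^ n := by
    rw [hu, dyadic]
    field_simp
    push_cast
    ring
  rw [hf, pointParity_coe, pointParity_coe, dyadic_sub, dyadic_sub]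
  have ht' : dyadic m b + 1 / 2 ^ m / (1 / 2 ^ n) * (t - dyadic n a) = ((b : ℤ) + u) / 2 ^ m := by
    rw [hu]
    unfold dyadic
    push_cast
    field_simp
  rw [ht', digitParity_add_div hu0 hu1 hud, ht, digitParity_add_div hu0 hu1 hud]
  unfold dyadic at e
  push_cast at e ⊢
  rw [e]
  ring

theorem MapsAffinely.eq_of_mem_Ico {f : UnitAddCircle → UnitAddCircle} {x y x' y' t : ℝ}
    (h : MapsAffinely f x y x' y') (ht : t ∈ Set.Ico x y) :
    f (t : UnitAddCircle) = ((x' + (y' - x') / (y - x) * (t - x) : ℝ) : UnitAddCircle) := by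
  have hxy : 0 < y - x := by linarith [ht.1, ht.2]
  have := h ((t - x) / (y - x)) ⟨div_nonneg (by linarith [ht.1]) hxy.le,
    (div_le_one hxy).2 (by linarith [ht.2])⟩
  exact map_coe_congr this (by field_simp; ring) (by ring)

theorem IsThompsonHomeo.exists_reduced_bipartite {f : UnitAddCircle ≃ₜ UnitAddCircle}
    (hf : IsThompsonHomeo f) (h : RespectsParity f) :
    ∃ P : TreePair, P.Represents f ∧ P.IsReduced ∧ P.thompsonGraph.IsBipartite := by
  obtain ⟨P, hred, hP⟩ := hf.exists_reduced
  obtain ⟨ε, hε⟩ := h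
  refine ⟨P, fun i a b c d hab hcd t ht => (hP i _ _ hab hcd).eq_of_mem_Ico ht, hred, ?_⟩
  -- The colour of a vertex is the digit parity of the left end of its input leaf. The default value
  -- is never used for actual leaves.
  let c : ℕ → ZMod 2 := fun i => digitParity (((leafIntervals P.input 0 1)[i]?).getD (0, 0)).1
  have hin : ∀ i j, ThompsonEdge P.input i j → c j = c i + 1 := by
    intro i j hE
    obtain ⟨p, q, hp, hq, hpq⟩ := hE.exists_leaves (n := 0) (a := 0)
    rw [← leafIntervals_zero_one] at hp hq
    simpa only [c, hp, hq, Option.getD_some] using hpq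
  have hval : ∀ i q, i < P.input.numLeaves →
      (leafIntervals P.output 0 1)[P.partner i]? = some q → digitParity q.1 = c i + ε := by
    intro i q hi hq
    obtain ⟨p, hp⟩ := exists_getElem? P.input 0 1 hi
    have hd : IsDyadicPoint (p.1 : UnitAddCircle) := by
      obtain ⟨n, a, -, rfl⟩ := eq_dyadic_of_getElem? hp
      exact isDyadicPoint_coe.2 (isDyadicReal_dyadic n a)
    have := hε _ hd
    rw [(hP i p q hp hq).map_left, pointParity_coe, pointParity_coe] at this
    simpa only [c, hp, Option.getD_some] using this
  have hout : ∀ i j, i < P.input.numLeaves → j < P.input.numLeaves →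
      ThompsonEdge P.output (P.partner i) (P.partner j) → c j = c i + 1 := by
    intro i j hi hj hE
    obtain ⟨p, q, hp, hq, hpq⟩ := hE.exists_leaves (n := 0) (a := 0)
    rw [← leafIntervals_zero_one] at hp hq
    rw [hval i p hi hp, hval j q hj hq] at hpq
    linear_combination hpq
  have hne : ∀ i j : Fin P.input.numLeaves, ThompsonEdge P.input i j ∨
      ThompsonEdge P.output (P.partner i) (P.partner j) → c j = c i + 1 := by
    rintro i j (hE | hE)
    · exact hin _ _ hE
    · exact hout _ _ i.2 j.2 hE
  have hcol : P.thompsonGraph.Colorable (Fintype.card (ZMod 2)) := by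
    refine (SimpleGraph.Coloring.mk (fun i : Fin P.input.numLeaves => c i) ?_).colorable
    intro i j hadj
    rw [TreePair.thompsonGraph, SimpleGraph.fromRel_adj] at hadj
    rcases hadj.2 with h | h <;> rw [hne _ _ h] <;> simp
  rwa [ZMod.card] at hcol

/-- Reducedness plays no role from left to right: any representing pair with bipartite graph forces
the parity condition. -/
theorem mem_jonesSet_iff (f : ThompsonT) : f ∈ jonesSet ↔ RespectsParity f.1 :=
  ⟨fun ⟨_, hP, _, hb⟩ => hP.respectsParity hb, fun h => IsThompsonHomeo.exists_reduced_bipartite f.2 h⟩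

/-- The Jones subgroup of Thompson's group `T`. -/
def jonesSubgroup : Subgroup ThompsonT where
  carrier := jonesSet
  one_mem' := (mem_jonesSet_iff 1).2 ⟨0, fun x _ => by simp⟩
  mul_mem' := by
    intro f g hf hg
    rw [mem_jonesSet_iff] at hf hg ⊢
    obtain ⟨ε, hε⟩ := hf
    obtain ⟨δ, hδ⟩ := hg
    refine ⟨δ + ε, fun x hx => ?_⟩
    change pointParity (f.1 (g.1 x)) = _
    rw [hε _ ((g.2.1 x).2 hx), hδ x hx, add_assoc]
  inv_mem' := by
    intro f hf
    rw [mem_jonesSet_iff] at hf ⊢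
    obtain ⟨ε, hε⟩ := hf
    refine ⟨-ε, fun x hx => ?_⟩
    change pointParity (f.1.symm x) = _
    have h := hε (f.1.symm x) ((f.2.1 _).1 (by rwa [f.1.apply_symm_apply]))
    rw [f.1.apply_symm_apply] at h
    rw [h, add_neg_cancel_right]

/-! ### An element of the Jones subgroup contracting towards `0` -/

/-- A piecewise affine homeomorphism of `[0, 1]` moving all interior points towards `0`. -/
noncomputable def pinch (x : ℝ) : ℝ := max (x / 2) (max (x - 3 / 8) (4 * x - 3))

/-- The inverse of `pinch`. -/
noncomputable def unpinch (y : ℝ) : ℝ := min (2 * y) (min (y + 3 / 8) ((y + 3) / 4))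

/-- The slopes 1/2, 1, 4 increase, so the map is convex and equals the maximum of its three affine
pieces. -/
theorem pinch_cases (x : ℝ) : (x < 3 / 4 ∧ pinch x = x / 2) ∨
    (3 / 4 ≤ x ∧ x < 7 / 8 ∧ pinch x = x - 3 / 8) ∨ (7 / 8 ≤ x ∧ pinch x = 4 * x - 3) := by
  unfold pinch
  grind

theorem unpinch_pinch (x : ℝ) : unpinch (pinch x) = x := by
  unfold unpinch pinch
  grind

theorem pinch_unpinch (x : ℝ) : pinch (unpinch x) = x := by
  unfold unpinch pinch
  grind

theorem pinch_mem {x : ℝ} (h : x ∈ Set.Ico (0 : ℝ) 1) : pinch x ∈ Set.Ico (0 : ℝ) 1 := by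
  obtain ⟨h0, h1⟩ := h
  unfold pinch
  constructor <;> grind

theorem unpinch_mem {x : ℝ} (h : x ∈ Set.Ico (0 : ℝ) 1) : unpinch x ∈ Set.Ico (0 : ℝ) 1 := by
  obtain ⟨h0, h1⟩ := h
  unfold unpinch
  constructor <;> grind

theorem unitAddCircle_coe_one : ((1 : ℝ) : UnitAddCircle) = ((0 : ℝ) : UnitAddCircle) :=
  unitAddCircle_coe_eq_iff.2 ⟨-1, by norm_num⟩

theorem liftIco_coe_apply {φ : ℝ → ℝ} {x : ℝ} (hx : x ∈ Set.Ico (0 : ℝ) 1) :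
    AddCircle.liftIco 1 0 (fun x => ((φ x : ℝ) : UnitAddCircle)) (x : UnitAddCircle) =
      ((φ x : ℝ) : UnitAddCircle) :=
  AddCircle.liftIco_zero_coe_apply hx

theorem liftIco_coe_continuous {φ : ℝ → ℝ} (hφ : Continuous φ) (h0 : φ 0 = 0) (h1 : φ 1 = 1) :
    Continuous (AddCircle.liftIco 1 0 (fun x => ((φ x : ℝ) : UnitAddCircle))) := by
  refine AddCircle.liftIco_zero_continuous ?_ ?_
  · rw [h0, h1, unitAddCircle_coe_one]
  · exact ((AddCircle.continuous_mk' 1).comp hφ).continuousOn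

/-- The homeomorphism of the circle induced by `pinch`. -/
noncomputable def pinchHomeo : UnitAddCircle ≃ₜ UnitAddCircle where
  toFun := AddCircle.liftIco 1 0 (fun x => ((pinch x : ℝ) : UnitAddCircle))
  invFun := AddCircle.liftIco 1 0 (fun x => ((unpinch x : ℝ) : UnitAddCircle))
  left_inv x := by
    obtain ⟨t, h0, h1, rfl⟩ := exists_coe_mem_Ico x
    rw [liftIco_coe_apply ⟨h0, h1⟩, liftIco_coe_apply (pinch_mem ⟨h0, h1⟩), unpinch_pinch]
  right_inv x := by
    obtain ⟨t, h0, h1, rfl⟩ := exists_coe_mem_Ico x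
    rw [liftIco_coe_apply ⟨h0, h1⟩, liftIco_coe_apply (unpinch_mem ⟨h0, h1⟩), pinch_unpinch]
  continuous_toFun := liftIco_coe_continuous (by unfold pinch; fun_prop) (by norm_num [pinch])
    (by norm_num [pinch])
  continuous_invFun := liftIco_coe_continuous (by unfold unpinch; fun_prop)
    (by norm_num [unpinch]) (by norm_num [unpinch])

theorem pinchHomeo_coe {x : ℝ} (hx : x ∈ Set.Ico (0 : ℝ) 1) :
    pinchHomeo (x : UnitAddCircle) = (pinch x : UnitAddCircle) :=
  liftIco_coe_apply hx

theorem isDyadicAffineAt_of_eqOn {f : UnitAddCircle → UnitAddCircle} {α β c x : ℝ} (k : ℤ)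
    (hx : x ∈ Set.Ioo α β)
    (h : ∀ y ∈ Set.Ioo α β, f (y : UnitAddCircle) = ((2 ^ k * y + c : ℝ) : UnitAddCircle)) :
    IsDyadicAffineAt f (x : UnitAddCircle) := by
  refine ⟨k, ?_⟩
  have hc : Filter.Tendsto (fun t : ℝ => x + t) (𝓝 0) (𝓝 x) := by
    have : Continuous (fun t : ℝ => x + t) := by fun_prop
    simpa using this.tendsto 0
  filter_upwards [hc.eventually (Ioo_mem_nhds hx.1 hx.2)] with t ht
  rw [← AddCircle.coe_add, h _ ht, h x hx, ← AddCircle.coe_add]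
  congr 1
  ring

theorem isDyadicReal_pinch {x : ℝ} : IsDyadicReal (pinch x) ↔ IsDyadicReal x := by
  have h38 : IsDyadicReal (3 / 8) := ⟨3, 3, by norm_num⟩
  have h3 := IsDyadicReal.intCast 3
  have h4 := IsDyadicReal.intCast 4
  have h2 := IsDyadicReal.intCast 2
  push_cast at h2 h3 h4
  rcases pinch_cases x with ⟨-, h⟩ | ⟨-, -, h⟩ | ⟨-, h⟩ <;> rw [h]
  · exact ⟨fun h => by simpa [mul_div_cancel₀] using h2.mul h, fun h => by simpa using h.div_pow 1⟩
  · exact ⟨fun h => by simpa using h.add h38, fun h => h.sub h38⟩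
  · refine ⟨fun h => ?_, fun h => (h4.mul h).sub h3⟩
    convert (h.add h3).div_pow 2 using 1
    ring

theorem isThompsonHomeo_pinchHomeo : IsThompsonHomeo pinchHomeo := by
  constructor
  · intro x
    obtain ⟨t, h0, h1, rfl⟩ := exists_coe_mem_Ico x
    rw [pinchHomeo_coe ⟨h0, h1⟩, isDyadicPoint_coe, isDyadicPoint_coe, isDyadicReal_pinch]
  · refine ⟨{((0 : ℝ) : UnitAddCircle), ((3 / 4 : ℝ) : UnitAddCircle),
      ((7 / 8 : ℝ) : UnitAddCircle)}, by simp, ?_, ?_⟩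
    · rintro x (rfl | rfl | rfl) <;> rw [isDyadicPoint_coe]
      · exact ⟨0, 0, by norm_num⟩
      · exact ⟨2, 3, by norm_num⟩
      · exact ⟨3, 7, by norm_num⟩
    · intro x hx
      obtain ⟨t, h0, h1, rfl⟩ := exists_coe_mem_Ico x
      simp only [Set.mem_insert_iff, Set.mem_singleton_iff, not_or] at hx
      have h00 : 0 < t := lt_of_le_of_ne h0 fun e => hx.1 (by rw [← e])
      have h34 : t ≠ 3 / 4 := fun e => hx.2.1 (by rw [e])
      have h78 : t ≠ 7 / 8 := fun e => hx.2.2 (by rw [e])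
      rcases pinch_cases t with ⟨h, -⟩ | ⟨h, h', -⟩ | ⟨h, -⟩
      · refine isDyadicAffineAt_of_eqOn (α := 0) (β := 3 / 4) (c := 0) (-1) ⟨h00, h⟩ ?_
        intro y hy
        rw [pinchHomeo_coe ⟨hy.1.le, by linarith [hy.2]⟩]
        congr 1
        rcases pinch_cases y with ⟨_, e⟩ | ⟨_, _, e⟩ | ⟨_, e⟩
        · rw [e]
          norm_num
          ring
        all_goals linarith [hy.2]
      · refine isDyadicAffineAt_of_eqOn (α := 3 / 4) (β := 7 / 8) (c := -(3 / 8)) 0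
          ⟨lt_of_le_of_ne h h34.symm, h'⟩ ?_
        intro y hy
        rw [pinchHomeo_coe ⟨by linarith [hy.1], by linarith [hy.2]⟩]
        congr 1
        rcases pinch_cases y with ⟨_, e⟩ | ⟨_, _, e⟩ | ⟨_, e⟩
        · linarith [hy.1]
        · rw [e]
          norm_num
          ring
        · linarith [hy.2]
      · refine isDyadicAffineAt_of_eqOn (α := 7 / 8) (β := 1) (c := -3) 2
          ⟨lt_of_le_of_ne h h78.symm, h1⟩ ?_
        intro y hy
        rw [pinchHomeo_coe ⟨by linarith [hy.1], by linarith [hy.2]⟩]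
        congr 1
        rcases pinch_cases y with ⟨_, e⟩ | ⟨_, _, e⟩ | ⟨_, e⟩
        · linarith [hy.1]
        · linarith [hy.1]
        · rw [e]
          norm_num
          ring

theorem digitParity_half_mul {t : ℝ} (h0 : 0 ≤ t) (h1 : t < 1) (ht : IsDyadicReal t) :
    digitParity (t / 2) = digitParity t := by
  simpa [digitParity_zero] using digitParity_add_div h0 h1 ht 0 1

/-- On the three pieces `pinch` puts a digit 0 in front, replaces the prefix 110 by 011, and
replaces 111 by 1. None of these changes the parity. -/
theorem digitParity_pinch {t : ℝ} (h0 : 0 ≤ t) (h1 : t < 1) (ht : IsDyadicReal t) :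
    digitParity (pinch t) = digitParity t := by
  have h14 : digitParity (1 / 4) = 1 := by
    have := digitParity_double_succ 0 1
    norm_num [digitParity_zero] at this
    simpa using this
  have h34 : digitParity (3 / 4) = 0 := by
    have := digitParity_double_succ 1 1
    norm_num at this
    rw [this, digitParity_half]
    rfl
  have h38 : digitParity (3 / 8) = 0 := by
    have := digitParity_double_succ 1 2
    norm_num at this
    rw [this, h14]
    rfl
  have h78 : digitParity (7 / 8) = 1 := by
    have := digitParity_double_succ 3 2
    norm_num at this
    rw [this, h34]
    rfl
  have hd : ∀ a : ℤ, IsDyadicReal (8 * t - a) := fun a =>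
    .sub (.mul (by exact_mod_cast IsDyadicReal.intCast 8) ht) (.intCast a)
  rcases pinch_cases t with ⟨h, e⟩ | ⟨h, h', e⟩ | ⟨h, e⟩ <;> rw [e]
  · exact digitParity_half_mul h0 h1 ht
  · have e1 := digitParity_add_div (t := 8 * t - (6 : ℤ)) (by push_cast; linarith)
      (by push_cast; linarith) (hd 6) 6 3
    have e2 := digitParity_add_div (t := 8 * t - (6 : ℤ)) (by push_cast; linarith)
      (by push_cast; linarith) (hd 6) 3 3
    push_cast at e1 e2
    rw [show (6 + (8 * t - 6)) / 2 ^ 3 = t by ring, show (6 : ℝ) / 2 ^ 3 = 3 / 4 by norm_num,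
      h34] at e1
    rw [show (3 + (8 * t - 6)) / 2 ^ 3 = t - 3 / 8 by ring, show (3 : ℝ) / 2 ^ 3 = 3 / 8 by norm_num,
      h38] at e2
    rw [e1, e2]
  · have e1 := digitParity_add_div (t := 8 * t - (7 : ℤ)) (by push_cast; linarith)
      (by push_cast; linarith) (hd 7) 7 3
    have e2 := digitParity_add_div (t := 8 * t - (7 : ℤ)) (by push_cast; linarith)
      (by push_cast; linarith) (hd 7) 1 1
    push_cast at e1 e2
    rw [show (7 + (8 * t - 7)) / 2 ^ 3 = t by ring, show (7 : ℝ) / 2 ^ 3 = 7 / 8 by norm_num,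
      h78] at e1
    rw [show (1 + (8 * t - 7)) / 2 ^ 1 = 4 * t - 3 by ring, show (1 : ℝ) / 2 ^ 1 = 1 / 2 by norm_num,
      digitParity_half] at e2
    rw [e1, e2]

theorem pointParity_pinchHomeo {x : UnitAddCircle} (hx : IsDyadicPoint x) :
    pointParity (pinchHomeo x) = pointParity x := by
  obtain ⟨t, h0, h1, rfl⟩ := exists_coe_mem_Ico x
  rw [pinchHomeo_coe ⟨h0, h1⟩, pointParity_coe, pointParity_coe,
    digitParity_pinch h0 h1 (isDyadicPoint_coe.1 hx)]

/-- `pinchHomeo` as an element of Thompson's group. -/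
noncomputable def pinchT : ThompsonT := ⟨pinchHomeo, isThompsonHomeo_pinchHomeo⟩

theorem pinchT_mem : pinchT ∈ jonesSubgroup :=
  (mem_jonesSet_iff pinchT).2 ⟨0, fun x hx => by
    rw [add_zero]
    exact pointParity_pinchHomeo hx⟩

/-! ### Iterates of `pinch`, and cosets fixed by powers of `pinchT` -/

theorem pinchT_pow_coe (n : ℕ) {x : ℝ} (hx : x ∈ Set.Ico (0 : ℝ) 1) :
    pinch^[n] x ∈ Set.Ico (0 : ℝ) 1 ∧
      (pinchT ^ n).1 (x : UnitAddCircle) = (pinch^[n] x : UnitAddCircle) := by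
  induction n with
  | zero => exact ⟨hx, rfl⟩
  | succ n ih =>
    rw [Function.iterate_succ_apply', pow_succ']
    refine ⟨pinch_mem ih.1, ?_⟩
    change pinchHomeo ((pinchT ^ n).1 (x : UnitAddCircle)) = _
    rw [ih.2, pinchHomeo_coe ih.1]

theorem pointParity_pinchT_pow (n : ℕ) {x : UnitAddCircle} (hx : IsDyadicPoint x) :
    pointParity ((pinchT ^ n).1 x) = pointParity x := by
  induction n with
  | zero => rfl
  | succ n ih =>
    rw [pow_succ', ← ih]
    exact pointParity_pinchHomeo (((pinchT ^ n).2.1 x).2 hx)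

theorem pinch_le_mul {ρ y x : ℝ} (hρ : 5 / 8 ≤ ρ) (hy : 0 < y) (hρy : 4 - 3 / y ≤ ρ) (h0 : 0 ≤ x)
    (hxy : x ≤ y) : pinch x ≤ ρ * x := by
  have h1 : (4 - 3 / y) * x ≤ ρ * x := mul_le_mul_of_nonneg_right hρy h0
  have h2 : 5 / 8 * x ≤ ρ * x := mul_le_mul_of_nonneg_right hρ h0
  have h3 : 3 / y * x ≤ 3 := by
    rw [div_mul_eq_mul_div, div_le_iff₀ hy]
    linarith
  rcases pinch_cases x with ⟨h, e⟩ | ⟨h, h', e⟩ | ⟨h, e⟩ <;> rw [e] <;> linarith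

theorem tendsto_iterate_pinch {x : ℝ} (hx : x ∈ Set.Ico (0 : ℝ) 1) :
    Filter.Tendsto (fun n => pinch^[n] x) Filter.atTop (𝓝 0) := by
  obtain ⟨h0, h1⟩ := hx
  obtain ⟨y, hy0, hy1, hxy⟩ : ∃ y : ℝ, 0 < y ∧ y < 1 ∧ x ≤ y :=
    ⟨max x (1 / 2), by positivity, by simp [h1]; norm_num, le_max_left _ _⟩
  have h3 : 1 < 1 / y := (one_lt_div hy0).2 hy1
  -- A contraction factor on `[0, y]`: 5/8 handles the first two pieces, as `x - 3/8 ≤ 5/8 * x` for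
  -- `x ≤ 1`, and `4 - 3 / y`, which is below 1 because `y < 1`, handles the steep one.
  obtain ⟨ρ, hρ, hρ1, hρy⟩ : ∃ ρ : ℝ, 5 / 8 ≤ ρ ∧ ρ < 1 ∧ 4 - 3 / y ≤ ρ := by
    refine ⟨max (5 / 8) (4 - 3 / y), le_max_left _ _, max_lt (by norm_num) ?_, le_max_right _ _⟩
    rw [show 3 / y = 3 * (1 / y) by ring]
    linarith
  have hb : ∀ n, pinch^[n] x ≤ ρ ^ n * x := by
    intro n
    induction n with
    | zero => simp
    | succ n ih =>
      have hn := (pinchT_pow_coe n ⟨h0, h1⟩).1.1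
      have hle : ρ ^ n * x ≤ x := mul_le_of_le_one_left h0 (pow_le_one₀ (by linarith) hρ1.le)
      rw [Function.iterate_succ_apply', pow_succ', mul_assoc]
      exact (pinch_le_mul hρ hy0 hρy hn (by linarith)).trans
        (mul_le_mul_of_nonneg_left ih (by linarith))
  refine squeeze_zero (fun n => (pinchT_pow_coe n ⟨h0, h1⟩).1.1) hb ?_
  simpa using (tendsto_pow_atTop_nhds_zero_of_lt_one (by linarith) hρ1).mul_const x

/-- A short standard interval starting at 0 goes affinely onto a standard interval, so a prefix of
zeros is replaced by a fixed prefix; `c` is the parity of the latter. -/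
theorem exists_parity_shift_near_zero {f : UnitAddCircle ≃ₜ UnitAddCircle} (hf : IsThompsonHomeo f) :
    ∃ δ > 0, ∃ c : ZMod 2, ∀ t, 0 ≤ t → t < δ → IsDyadicReal t →
      pointParity (f (t : UnitAddCircle)) = digitParity t + c := by
  obtain ⟨N, hN⟩ := hf.exists_good_level
  obtain ⟨m, b, hb, h⟩ := hN 0 (by positivity)
  have hp : (0 : ℝ) < 2 ^ N := by positivity
  refine ⟨1 / 2 ^ N, by positivity, digitParity (b / 2 ^ m), fun t h0 h1 ht => ?_⟩
  have hu0 : 0 ≤ 2 ^ N * t := by positivity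
  have hu1 : 2 ^ N * t < 1 := by rwa [← lt_div_iff₀' hp]
  have hu : IsDyadicReal (2 ^ N * t) := by
    refine .mul ?_ ht
    exact_mod_cast IsDyadicReal.natCast (2 ^ N)
  have e := h _ ⟨hu0, hu1.le⟩
  rw [dyadic_sub, dyadic_sub] at e
  have e1 : dyadic N 0 + 1 / 2 ^ N * (2 ^ N * t) = t := by
    unfold dyadic
    field_simp
    simp
  have e2 : dyadic m b + 1 / 2 ^ m * (2 ^ N * t) = ((b : ℤ) + 2 ^ N * t) / 2 ^ m := by
    unfold dyadic
    push_cast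
    ring
  have e3 : digitParity t = digitParity (2 ^ N * t) := by
    have := digitParity_add_div hu0 hu1 hu 0 N
    rwa [Int.cast_zero, zero_add, mul_div_cancel_left₀ _ hp.ne', zero_div, digitParity_zero,
      zero_add] at this
  rw [e1, e2] at e
  rw [e, pointParity_coe, digitParity_add_div hu0 hu1 hu, e3, add_comm]
  push_cast
  rfl

theorem pinchT_pow_smul_ne {g : ThompsonT} (hg : g ∉ jonesSubgroup) {n : ℕ} (hn : 0 < n) :
    pinchT ^ n • (g : ThompsonT ⧸ jonesSubgroup) ≠ g := by
  intro h
  have h1 : g⁻¹ * (pinchT ^ n * g) ∈ jonesSubgroup := QuotientGroup.eq.1 h.symm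
  obtain ⟨ε, hε⟩ := (mem_jonesSet_iff _).1 h1
  have hstep : ∀ y, IsDyadicPoint y → pointParity (g.1.symm ((pinchT ^ n).1 y)) =
      pointParity (g.1.symm y) + ε := by
    intro y hy
    have h2 := hε (g.1.symm y) ((g.2.1 _).1 (by rwa [g.1.apply_symm_apply]))
    change pointParity (g.1.symm ((pinchT ^ n).1 (g.1 (g.1.symm y)))) = _ at h2
    rwa [g.1.apply_symm_apply] at h2
  -- The map `pinch` fixes 0, so evaluating there rules out a parity reversal.
  have hε0 : ε = 0 := by
    have h3 := hstep ((0 : ℝ) : UnitAddCircle) (isDyadicPoint_coe.2 ⟨0, 0, by norm_num⟩)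
    have h4 : ∀ k, pinch^[k] 0 = 0 := fun k =>
      Function.iterate_fixed (by norm_num [pinch]) k
    rw [(pinchT_pow_coe n (by norm_num)).2, h4] at h3
    simpa using h3
  subst hε0
  have hiter : ∀ k y, IsDyadicPoint y → pointParity (g.1.symm ((pinchT ^ (n * k)).1 y)) =
      pointParity (g.1.symm y) := by
    intro k y hy
    induction k with
    | zero => rfl
    | succ k ih =>
      rw [mul_add, mul_one, add_comm, pow_add, ← ih]
      have := hstep _ (((pinchT ^ (n * k)).2.1 y).2 hy)
      rwa [add_zero] at this
  obtain ⟨δ, hδ, c, hc⟩ := exists_parity_shift_near_zero (ThompsonT.inv_mem g.2)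
  apply hg
  rw [← inv_mem_iff]
  refine (mem_jonesSet_iff _).2 ⟨c, fun y hy => ?_⟩
  change pointParity (g.1.symm y) = _
  obtain ⟨t, h0, h1, rfl⟩ := exists_coe_mem_Ico y
  have htend := (tendsto_iterate_pinch ⟨h0, h1⟩).comp
    (Filter.tendsto_id.const_mul_atTop' hn)
  -- Enough steps bring the point into the region near 0 where `g⁻¹` shifts parity by `c`. Neither
  -- its own parity nor that of its image under `g⁻¹` has changed on the way.
  obtain ⟨k, hk⟩ := (htend.eventually (gt_mem_nhds hδ)).exists
  have hcoe := pinchT_pow_coe (n * k) ⟨h0, h1⟩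
  have hdy : IsDyadicReal (pinch^[n * k] t) := by
    rw [← isDyadicPoint_coe, ← hcoe.2]
    exact ((pinchT ^ (n * k)).2.1 _).2 hy
  have := hc _ hcoe.1.1 hk hdy
  rw [← pointParity_coe, ← hcoe.2, pointParity_pinchT_pow _ hy] at this
  rw [← hiter k _ hy]
  exact this

/-! ### Irreducibility of quasiregular representations -/

section Quasiregular

variable {G : Type*} [Group G] {H : Subgroup G}

theorem quasiregular_apply (g : G) (v : ellTwo (G ⧸ H)) (x : G ⧸ H) :
    quasiregular H g v x = v (g⁻¹ • x) := rfl

theorem inner_quasiregular (g : G) (u v : ellTwo (G ⧸ H)) :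
    inner ℂ (quasiregular H g u) v = inner ℂ u (quasiregular H g⁻¹ v) := by
  conv_lhs => rw [show v = quasiregular H g (quasiregular H g⁻¹ v) by
    ext x; simp]
  exact (quasiregular H g).inner_map_map _ _

open scoped Classical in
theorem quasiregular_single (g : G) (x : G ⧸ H) :
    quasiregular H g (lp.single 2 x (1 : ℂ)) = lp.single 2 (g • x) (1 : ℂ) := by
  ext y
  rw [quasiregular_apply, lp.single_apply, lp.single_apply, Pi.single_apply, Pi.single_apply]
  simp only [inv_smul_eq_iff]

theorem quasiregular_mem_orthogonal {W : Submodule ℂ (ellTwo (G ⧸ H))}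
    (hW : ∀ g : G, ∀ v ∈ W, quasiregular H g v ∈ W) (g : G) {v : ellTwo (G ⧸ H)} (hv : v ∈ Wᗮ) :
    quasiregular H g v ∈ Wᗮ := by
  rw [Submodule.mem_orthogonal'] at hv ⊢
  intro u hu
  rw [inner_quasiregular]
  exact hv _ (hW _ _ hu)

-- The point mass at the base coset is cyclic: its translates are all the point masses, and a vector
-- orthogonal to these vanishes.
open scoped Classical in
theorem eq_zero_of_forall_single {W : Submodule ℂ (ellTwo (G ⧸ H))}
    (hW : ∀ g : G, ∀ v ∈ W, quasiregular H g v ∈ W)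
    (he : lp.single 2 ((1 : G) : G ⧸ H) (1 : ℂ) ∈ W) {v : ellTwo (G ⧸ H)} (hv : v ∈ Wᗮ) : v = 0 := by
  ext x
  obtain ⟨g, rfl⟩ := QuotientGroup.mk_surjective x
  have h1 := hW g _ he
  rw [quasiregular_single, show g • ((1 : G) : G ⧸ H) = g by
    change ((g * 1 : G) : G ⧸ H) = _
    rw [mul_one]] at h1
  have h2 := (Submodule.mem_orthogonal W v).1 hv _ h1
  rw [lp.inner_single_left] at h2
  simpa using h2

/-- An invariant vector is constant along the orbit, and a constant is square summable over an
infinite set only if it is 0. -/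
theorem apply_eq_zero_of_infinite_orbit {h : G} {v : ellTwo (G ⧸ H)} (hv : quasiregular H h v = v)
    {x : G ⧸ H} (hx : ∀ n, 0 < n → h ^ n • x ≠ x) : v x = 0 := by
  have hinv : ∀ n : ℕ, v (h ^ n • x) = v x := by
    intro n
    induction n with
    | zero => simp
    | succ n ih =>
      rw [← ih]
      conv_lhs => rw [← hv]
      rw [quasiregular_apply, pow_succ', mul_smul, inv_smul_smul]
  have hinj : Function.Injective fun n : ℕ => h ^ n • x := by
    intro n m hnm
    by_contra hne
    wlog hlt : n < m generalizing n m
    · exact this hnm.symm (Ne.symm hne) (by omega)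
    refine hx (m - n) (by omega) ?_
    beta_reduce at hnm
    rw [← Nat.add_sub_cancel' hlt.le, pow_add, mul_smul] at hnm
    exact (smul_left_cancel _ hnm).symm
  have hs := (memℓp_gen_iff (by norm_num)).1 (lp.memℓp v)
  have hs' := hs.comp_injective hinj
  have hc : (fun y => ‖v y‖ ^ (2 : ENNReal).toReal) ∘ (fun n : ℕ => h ^ n • x) =
      fun _ => ‖v x‖ ^ (2 : ENNReal).toReal := by
    funext n
    simp only [Function.comp_apply, hinv]
  rw [hc, summable_const_iff] at hs'
  simpa using hs'

/-- The projection `p` of the point mass `e` to an invariant subspace is fixed by `H`, so it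
vanishes off the base coset and is a multiple of `e`. Hence `e` lies in the subspace or in its
orthogonal complement, and cyclicity finishes the proof. -/
theorem quasiregular_irreducible
    (hH : ∀ g ∉ H, ∃ h ∈ H, ∀ n, 0 < n → h ^ n • (g : G ⧸ H) ≠ g) :
    IsIrreducibleUnitary (quasiregular H) := by
  classical
  set e : ellTwo (G ⧸ H) := lp.single 2 ((1 : G) : G ⧸ H) (1 : ℂ) with he
  have he1 : e ((1 : G) : G ⧸ H) = 1 := by simp [he]
  refine ⟨⟨e, 0, fun h => by simp [h] at he1⟩, fun W hWc hW => ?_⟩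
  have : CompleteSpace W := hWc.completeSpace_coe
  obtain ⟨p, hp, q, hq, hpq⟩ := W.exists_add_mem_mem_orthogonal e
  have hinv : ∀ h ∈ H, quasiregular H h p = p := by
    intro h hh
    have h1 : quasiregular H h e = e := by
      rw [he, quasiregular_single]
      congr 1
      change ((h * 1 : G) : G ⧸ H) = _
      rw [QuotientGroup.eq]
      simpa using hh
    have h2 : quasiregular H h p - p = q - quasiregular H h q := by
      rw [hpq, map_add] at h1
      rw [sub_eq_sub_iff_add_eq_add, h1, add_comm]
    -- Uniqueness of the orthogonal decomposition of the fixed vector `e`.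
    have h3 : quasiregular H h p - p ∈ W ⊓ Wᗮ :=
      ⟨W.sub_mem (hW _ _ hp) hp, h2 ▸ Wᗮ.sub_mem hq (quasiregular_mem_orthogonal hW _ hq)⟩
    rw [Submodule.inf_orthogonal_eq_bot, Submodule.mem_bot] at h3
    exact sub_eq_zero.1 h3
  have hpe : p = p ((1 : G) : G ⧸ H) • e := by
    ext x
    obtain ⟨g, rfl⟩ := QuotientGroup.mk_surjective x
    by_cases hg : g ∈ H
    · rw [show (QuotientGroup.mk g : G ⧸ H) = ((1 : G) : G ⧸ H) from
        QuotientGroup.eq.2 (by simpa using hg)]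
      simp [he1]
    · have hne : (QuotientGroup.mk g : G ⧸ H) ≠ ((1 : G) : G ⧸ H) := fun h =>
        hg (by simpa using QuotientGroup.eq.1 h)
      obtain ⟨h, hh, hn⟩ := hH g hg
      rw [apply_eq_zero_of_infinite_orbit (hinv h hh) hn]
      simp [he, lp.single_apply, hne]
  by_cases hc : p ((1 : G) : G ⧸ H) = 0
  · left
    rw [hc, zero_smul] at hpe
    rw [hpe, zero_add] at hpq
    rw [Submodule.eq_bot_iff]
    intro w hw
    -- Cyclicity is applied to `Wᗮ`, which contains `e`; each `w ∈ W` is orthogonal to it.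
    exact eq_zero_of_forall_single (fun g v hv => quasiregular_mem_orthogonal hW g hv)
      (by rw [← he, hpq]; exact hq) (W.le_orthogonal_orthogonal hw)
  · right
    have heW : e ∈ W := by
      rw [hpe] at hp
      exact (W.smul_mem_iff hc).1 hp
    rw [← Submodule.orthogonal_eq_bot_iff, Submodule.eq_bot_iff]
    exact fun v hv => eq_zero_of_forall_single hW heW hv

end Quasiregular

theorem mainTheorem4 :
    ∃ H : Subgroup ThompsonT, (H : Set ThompsonT) = jonesSet ∧
      IsIrreducibleUnitary (quasiregular H) :=
  ⟨jonesSubgroup, rfl,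
    quasiregular_irreducible fun _ hg => ⟨pinchT, pinchT_mem, fun _ => pinchT_pow_smul_ne hg⟩⟩
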